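/- Let $q>0$, $q\neq 1$ (a positive real number that is not a root of unity), $[x]=\frac{q^x-q^{-x}}{q-q^{-1}}$, $[n]!=[n][n-1]\cdots[1]$, $[0]!=1$. A unitary representation of $u_q(2,1)$ is a complex pre-Hilbert space $V$ with operators $A_{ik}$ ($i,k=1,2,3$) on $V$ such that: the $A_{ii}$ commute and $V$ is spanned by their joint eigenvectors (weight vectors); $[A_{ii},A_{jk}]=(\delta_{ij}-\delta_{ik})A_{jk}$ for $j\ne k$; $[A_{12},A_{21}]=[A_{11}-A_{22}]$ and $[A_{23},A_{32}]=[A_{22}-A_{33}]$ (the right-hand sides act on a vector of weight $m$ by the $q$-numbers $[m_1-m_2]$, $[m_2-m_3]$); $[A_{12},A_{32}]=[A_{23},A_{21}]=0$; the pairs $(A_{12},A_{23})$ and $(A_{21},A_{32})$ satisfy the $q$-Serre relations $X^2Y-(q+q^{-1})XYX+YX^2=0$ in both orders; $A_{13}=A_{12}A_{23}-qA_{23}A_{12}$, $A_{31}=A_{32}A_{21}-q^{-1}A_{21}A_{32}$; and $A_{ii}^+=A_{ii}$, $A_{12}^+=A_{21}$, $A_{23}^+=-A_{32}$. Let $f_1,f_2,f_3$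 be integers with $f_1\ge f_2$ and $f_2-f_3\ge 2$, and let $V$ be an irreducible unitary representation of $u_q(2,1)$ with a lowest weight vector $|L\rangle$: $A_{ii}|L\rangle=f_i|L\rangle$, $A_{31}|L\rangle=A_{32}|L\rangle=A_{12}|L\rangle=0$, $\langle L|L\rangle=1$. Put $$P^U=\sum_{r\ge0}(-1)^r\frac{[2U+1]!}{[r]!\,[2U+r+1]!}A_{21}^rA_{12}^r,\qquad P^T=\sum_{r=0}^{2T}\frac{[2T-r]!}{[r]!\,[2T]!}A_{23}^rA_{32}^r .$$ For integers $k,\ell\ge0$ with $k\le f_1-f_2$, $U=\frac12(f_1-f_2-k+\ell)$, $m_3=f_3-k-\ell$ and $M_U\in\{-U,-U+1,\dots,U\}$, the $U$-basis vector is $$|\langle f\rangle m_3UM_U\rangle_q=\frac{1}{N(k\ell)N(UM_U)}A_{21}^{U-M_U}P^UA_{23}^kA_{13}^\ell|L\rangle,\qquad N(UM_U)^2=\frac{[2U]!\,[U-M_U]!}{[U+M_U]!},$$ and for integers $s,p\ge0$ with $p\le f_1-f_2$, $T=\frac12(f_2-f_3+p+s-2)$, $m_1=f_1-p+s$ and $M\in\{T+1,T+2,\dots\}$,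 the $T$-basis vector is $$|\langle f\rangle m_1TM\rangle_q=\frac{1}{N(sp)N(TM)}A_{23}^{M-T-1}P^TA_{13}^sA_{21}^p|L\rangle,\qquad N(TM)^2=\frac{[M-T-1]!\,[T+M]!}{[2T+1]!},$$ where $N(k\ell)=\|P^UA_{23}^kA_{13}^\ell|L\rangle\|$ and $N(sp)=\|P^TA_{13}^sA_{21}^p|L\rangle\|$. If the two vectors have the same weight, that is, $U-M_U=p-s+\ell$ and $M-T-1=k+\ell-s$, then the $q$-Weyl coefficient $\langle U|T\rangle_q={}_q\langle\langle f\rangle m_3UM_U|\langle f\rangle m_1TM\rangle_q$ equals $$\left\{\frac{[2U+1][2T+1][k]!\,[M-T-1]!\,[U+M_U]!\,[T+M]!}{[p]!\,[s]!\,[\ell]!\,[U-M_U]!\,[f_1-f_3+s-1]!}\cdot\frac{[f_1-f_2-k]!\,[f_1-f_2+\ell+1]!\,[f_2-f_3+s-2]!\,[f_2-f_3+p-2]!}{[f_1-f_2-p]!\,[f_2-f_3+k-2]!\,[f_1-f_3+\ell-1]!}\right\}^{1/2}\Sigma,$$ where $$\Sigma=\sum_r(-1)^r\frac{[U-M_U+r]!\,[\ell+r]!\,[f_1-f_3+\ell+r-1]!}{[r]!\,[2U+r+1]!\,[k-r]!\,[\ell-s+r]!\,[f_2-f_3+p+\ell+r-1]!}$$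 and, equivalently (with $r=k-n$), $$\Sigma=\sum_n\frac{(-1)^{k+n}[U-M_U+k-n]!\,[\ell+k-n]!}{[n]!\,[k-n]!\,[2U+1+k-n]!\,[\ell-s+k-n]!}\cdot\frac{[f_1-f_3+\ell+k-n-1]!}{[f_2-f_3+p+\ell+k-n-1]!};$$ both sums run over the integers for which all the arguments of the $q$-factorials are nonnegative. -/

import Mathlib

namespace UqTwoOne

noncomputable section

/-- The symmetric `q`-number `[x] = (q^x - q^(-x)) / (q - q⁻¹)`, for `q > 0`, `q ≠ 1`. -/
def qNum (q x : ℝ) : ℝ := (q ^ x - q ^ (-x)) / (q - q⁻¹)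

/-- The `q`-factorial `[n]! = [n][n-1]⋯[1]`, `[0]! = 1`, of an integer `n ≥ 0`
(it is only ever used at nonnegative integers). -/
def qFact (q : ℝ) (n : ℤ) : ℝ := ∏ i ∈ Finset.range n.toNat, qNum q ((i : ℝ) + 1)

variable {V : Type*} [NormedAddCommGroup V] [InnerProductSpace ℂ V]

/-- The joint eigenspace of `A 0 0`, `A 1 1`, `A 2 2` of weight `m`. -/
def weightSpace (A : Fin 3 → Fin 3 → Module.End ℂ V) (m : Fin 3 → ℝ) : Submodule ℂ V :=
  ⨅ i, Module.End.eigenspace (A i i) (m i : ℂ)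

/-- A unitary (that is, Hermitian) representation of the quantum algebra `u_q(2,1)` on a complex
pre-Hilbert space `V`. The generator `A_{ik}` is `A (i-1) (k-1)`, so `A_{12} = A 0 1`,
`A_{23} = A 1 2`, `A_{31} = A 2 0`, and so on. The generators are in general unbounded, so `V` is
not assumed complete: it is the common invariant domain on which all of them act.
The bracket `[A_{11} - A_{22}]` is the function `[·]` of a diagonalizable operator, so
it acts on a vector of weight `m` by the `q`-number `[m_1 - m_2]`. -/
structure UnitaryRep (q : ℝ) (V : Type*) [NormedAddCommGroup V] [InnerProductSpace ℂ V] where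
  A : Fin 3 → Fin 3 → Module.End ℂ V
  /-- `V` is spanned by weight vectors. -/
  iSup_weightSpace : ⨆ m : Fin 3 → ℝ, weightSpace A m = ⊤
  cartan_comm : ∀ i j, A i i * A j j = A j j * A i i
  cartan_root : ∀ i j k, j ≠ k →
    A i i * A j k - A j k * A i i =
      ((if i = j then (1 : ℂ) else 0) - (if i = k then (1 : ℂ) else 0)) • A j k
  comm_12_21 : ∀ m : Fin 3 → ℝ, ∀ v ∈ weightSpace A m,
    (A 0 1 * A 1 0 - A 1 0 * A 0 1) v = (qNum q (m 0 - m 1) : ℂ) • v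
  comm_23_32 : ∀ m : Fin 3 → ℝ, ∀ v ∈ weightSpace A m,
    (A 1 2 * A 2 1 - A 2 1 * A 1 2) v = (qNum q (m 1 - m 2) : ℂ) • v
  comm_12_32 : A 0 1 * A 2 1 = A 2 1 * A 0 1
  comm_23_21 : A 1 2 * A 1 0 = A 1 0 * A 1 2
  serre_12_23 : A 0 1 ^ 2 * A 1 2 - ((q + q⁻¹ : ℝ) : ℂ) • (A 0 1 * A 1 2 * A 0 1)
    + A 1 2 * A 0 1 ^ 2 = 0
  serre_23_12 : A 1 2 ^ 2 * A 0 1 - ((q + q⁻¹ : ℝ) : ℂ) • (A 1 2 * A 0 1 * A 1 2)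
    + A 0 1 * A 1 2 ^ 2 = 0
  serre_21_32 : A 1 0 ^ 2 * A 2 1 - ((q + q⁻¹ : ℝ) : ℂ) • (A 1 0 * A 2 1 * A 1 0)
    + A 2 1 * A 1 0 ^ 2 = 0
  serre_32_21 : A 2 1 ^ 2 * A 1 0 - ((q + q⁻¹ : ℝ) : ℂ) • (A 2 1 * A 1 0 * A 2 1)
    + A 1 0 * A 2 1 ^ 2 = 0
  /-- `A_{13} = A_{12} A_{23} - q A_{23} A_{12}`. -/
  eq_13 : A 0 2 = A 0 1 * A 1 2 - (q : ℂ) • (A 1 2 * A 0 1)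
  /-- `A_{31} = A_{32} A_{21} - q⁻¹ A_{21} A_{32}`. -/
  eq_31 : A 2 0 = A 2 1 * A 1 0 - ((q⁻¹ : ℝ) : ℂ) • (A 1 0 * A 2 1)
  /-- `A_{ii}⁺ = A_{ii}`. -/
  adj_diag : ∀ i, ∀ x y : V, inner ℂ (A i i x) y = inner ℂ x (A i i y)
  /-- `A_{12}⁺ = A_{21}`. -/
  adj_12 : ∀ x y : V, inner ℂ (A 0 1 x) y = inner ℂ x (A 1 0 y)
  /-- `A_{23}⁺ = -A_{32}`: this is where `u_q(2,1)` differs from `u_q(3)`. -/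
  adj_23 : ∀ x y : V, inner ℂ (A 1 2 x) y = -inner ℂ x (A 2 1 y)

/-- The representation `R` is the irreducible representation `D^⟨f⟩` of the positive discrete
series, with normalized lowest weight vector `L` of weight `(f₁, f₂, f₃)`. -/
structure IsPositiveDiscrete {q : ℝ} (R : UnitaryRep q V) (f₁ f₂ f₃ : ℤ) (L : V) : Prop where
  irreducible : ∀ W : Submodule ℂ V, (∀ i j, ∀ v ∈ W, R.A i j v ∈ W) → W = ⊥ ∨ W = ⊤
  weight_1 : R.A 0 0 L = (f₁ : ℂ) • L
  weight_2 : R.A 1 1 L = (f₂ : ℂ) • L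
  weight_3 : R.A 2 2 L = (f₃ : ℂ) • L
  ann_31 : R.A 2 0 L = 0
  ann_32 : R.A 2 1 L = 0
  ann_12 : R.A 0 1 L = 0
  norm_L : inner ℂ L L = 1

namespace UnitaryRep

variable {q : ℝ} (R : UnitaryRep q V)

/-- The projection operator of the `su_q(2)` subalgebra generated by `A_{12}`, `A_{21}`,
`P^U = ∑_{r ≥ 0} (-1)^r [2U+1]! / ([r]! [2U+r+1]!) A_{21}^r A_{12}^r`, with `n = 2U`.
It is applied to vectors killed by a power of `A_{12}`, where the sum is finite. -/
def projU (n : ℤ) (v : V) : V :=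
  ∑ᶠ r : ℕ, (((-1) ^ r * qFact q (n + 1) / (qFact q r * qFact q (n + r + 1)) : ℝ) : ℂ) •
    (R.A 1 0 ^ r) ((R.A 0 1 ^ r) v)

/-- The projection operator of the `su_q(1,1)` subalgebra generated by `A_{23}`, `A_{32}`,
`P^T = ∑_{r = 0}^{2T} [2T-r]! / ([r]! [2T]!) A_{23}^r A_{32}^r`, with `n = 2T`. -/
def projT (n : ℤ) (v : V) : V :=
  ∑ r ∈ Finset.range (n.toNat + 1),
    ((qFact q (n - r) / (qFact q r * qFact q n) : ℝ) : ℂ) •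
      (R.A 1 2 ^ r) ((R.A 2 1 ^ r) v)

/-- `P^U A_{23}^k A_{13}^ℓ |L⟩` with `2U = f₁ - f₂ - k + ℓ`. -/
def highU (f₁ f₂ : ℤ) (L : V) (k l : ℕ) : V :=
  R.projU (f₁ - f₂ - k + l) ((R.A 1 2 ^ k) ((R.A 0 2 ^ l) L))

/-- The `U`-basis vector `|⟨f⟩ m₃ U M_U⟩_q`, where `m₃ = f₃ - k - ℓ`,
`2U = f₁ - f₂ - k + ℓ`, `M_U = U - a`:
`N(kℓ)⁻¹ N(U M_U)⁻¹ A_{21}^{U - M_U} P^U A_{23}^k A_{13}^ℓ |L⟩`,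
where `N(kℓ)` normalizes `P^U A_{23}^k A_{13}^ℓ |L⟩` and
`N(U M_U) = √([2U]! [U - M_U]! / [U + M_U]!)`. -/
def uVec (f₁ f₂ : ℤ) (L : V) (k l a : ℕ) : V :=
  (((‖R.highU f₁ f₂ L k l‖ *
      Real.sqrt (qFact q (f₁ - f₂ - k + l) * qFact q a / qFact q (f₁ - f₂ - k + l - a)))⁻¹ : ℝ) : ℂ)
    • (R.A 1 0 ^ a) (R.highU f₁ f₂ L k l)

/-- `P^T A_{13}^s A_{21}^p |L⟩` with `2T = f₂ - f₃ + p + s - 2`. -/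
def lowT (f₂ f₃ : ℤ) (L : V) (s p : ℕ) : V :=
  R.projT (f₂ - f₃ + p + s - 2) ((R.A 0 2 ^ s) ((R.A 1 0 ^ p) L))

/-- The `T`-basis vector `|⟨f⟩ m₁ T M⟩_q`, where `m₁ = f₁ - p + s`,
`2T = f₂ - f₃ + p + s - 2`, `M = T + 1 + b`:
`N(sp)⁻¹ N(T M)⁻¹ A_{23}^{M - T - 1} P^T A_{13}^s A_{21}^p |L⟩`,
where `N(sp)` normalizes `P^T A_{13}^s A_{21}^p |L⟩` and
`N(T M) = √([M - T - 1]! [T + M]! / [2T + 1]!)`. -/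
def tVec (f₂ f₃ : ℤ) (L : V) (s p b : ℕ) : V :=
  (((‖R.lowT f₂ f₃ L s p‖ *
      Real.sqrt (qFact q b * qFact q (f₂ - f₃ + p + s - 2 + 1 + b) /
        qFact q (f₂ - f₃ + p + s - 2 + 1)))⁻¹ : ℝ) : ℂ)
    • (R.A 1 2 ^ b) (R.lowT f₂ f₃ L s p)

end UnitaryRep

/-- The square-root prefactor of the `q`-Weyl coefficient, with `n = 2U`, `t = 2T`,
`a = U - M_U` and `b = M - T - 1`. -/
def weylPrefactor (q : ℝ) (f₁ f₂ f₃ : ℤ) (k l s p a b : ℕ) (n t : ℤ) : ℝ :=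
  Real.sqrt
    (qNum q (n + 1) * qNum q (t + 1) * qFact q k * qFact q b * qFact q (n - a) *
        qFact q (t + 1 + b) /
      (qFact q p * qFact q s * qFact q l * qFact q a * qFact q (f₁ - f₃ + s - 1)) *
    (qFact q (f₁ - f₂ - k) * qFact q (f₁ - f₂ + l + 1) * qFact q (f₂ - f₃ + s - 2) *
        qFact q (f₂ - f₃ + p - 2) /
      (qFact q (f₁ - f₂ - p) * qFact q (f₂ - f₃ + k - 2) * qFact q (f₁ - f₃ + l - 1))))

/-- The sum over `r` in the `q`-Weyl coefficient, with `n = 2U` and `a = U - M_U`; it runs over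
all `r` for which every factorial has a nonnegative argument. -/
def weylSum (q : ℝ) (f₁ f₂ f₃ : ℤ) (k l s p a : ℕ) (n : ℤ) : ℝ :=
  ∑ r ∈ (Finset.range (k + 1)).filter (fun r => s ≤ l + r),
    (-1) ^ r * (qFact q (a + r) * qFact q (l + r) * qFact q (f₁ - f₃ + l + r - 1)) /
      (qFact q r * qFact q (n + r + 1) * qFact q (k - r) * qFact q (l - s + r) *
        qFact q (f₂ - f₃ + p + l + r - 1))

/-- The same sum written in the variable `j = k - r` (with `n = 2U` and `a = U - M_U`). -/
def weylSum' (q : ℝ) (f₁ f₂ f₃ : ℤ) (k l s p a : ℕ) (n : ℤ) : ℝ :=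
  ∑ j ∈ (Finset.range (k + 1)).filter (fun j => s + j ≤ l + k),
    (-1) ^ (k + j) * (qFact q (a + k - j) * qFact q (l + k - j)) /
        (qFact q j * qFact q (k - j) * qFact q (n + 1 + k - j) * qFact q (l - s + k - j)) *
      (qFact q (f₁ - f₃ + l + k - j - 1) / qFact q (f₂ - f₃ + p + l + k - j - 1))

end

end UqTwoOne

/-! The overlap is evaluated by pushing lowering operators onto vectors where their action is
explicit. Each `A_{12}` applied to `A_{23}^k A_{13}^ℓ |L⟩` trades one `A_{23}` for one `A_{13}`, so
`P^U A_{23}^k A_{13}^ℓ |L⟩` is a finite combination of the vectors `A_{23}^{k-r} A_{21}^r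
A_{13}^{ℓ+r} |L⟩` (`projU_pow_23_pow_13`). The remaining `A_{21}^a` commutes with `A_{23}`. Now
`A_{23}^{k-r}` crosses the inner product as `(-A_{32})^{k-r}` and meets `A_{23}^b` on a vector
killed by `A_{32}`, leaving `A_{23}^j` with `j = ℓ + r - s`, or zero if `j < 0`. This `A_{23}^j`
crosses back and removes `j` factors `A_{21}` and `j` factors `A_{13}`. Because the weights agree,
`A_{21}^p A_{13}^s |L⟩` is left for every `r`, and the sum over `r` multiplies one common inner
product (`inner_pow_21_highU_pow_23_lowT`), which is the squared norm of the `T`-vector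
(`inner_lowT`).

The norms need only two facts about each projection `P`: `P v` is annihilated by the relevant
`A_{12}` or `A_{32}` (a telescoping sum), and `P v - v` lies in the image of that operator's
adjoint, up to sign. Hence `⟨P v, P v⟩ = ⟨v, P v⟩`. Moreover `A_{32}` and `A_{12}` commute, and each
maps the extremal vectors of the other's subalgebra to multiples of extremal vectors:
`apply_32_projU` lowers `k` and `apply_12_projT` lowers `p`. Induction ends at the norm of `A_{13}^ℓ
|L⟩` (`inner_pow_13_eq`). The prefactor is then identified by comparing squares
(`weylPrefactor_eq`). -/

namespace UqTwoOne

variable {V : Type*} [NormedAddCommGroup V] [InnerProductSpace ℂ V]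

/-! ### Arithmetic of `q`-numbers and `q`-factorials. -/

section QNumbers

variable {q : ℝ}

theorem sub_inv_ne_zero (hq : 0 < q) (hq1 : q ≠ 1) : q - q⁻¹ ≠ 0 := by
  intro h
  have h2 : q * q = 1 := by
    have : q = q⁻¹ := by linarith
    nth_rewrite 2 [this]
    exact mul_inv_cancel₀ hq.ne'
  have : (q - 1) * (q + 1) = 0 := by linarith
  rcases mul_eq_zero.1 this with h | h
  · exact hq1 (by linarith)
  · linarith

@[simp] theorem qNum_zero (q : ℝ) : qNum q 0 = 0 := by simp [qNum]

theorem qNum_neg (q x : ℝ) : qNum q (-x) = -qNum q x := by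
  simp only [qNum, neg_neg]
  ring

theorem qNum_one (hq : 0 < q) (hq1 : q ≠ 1) : qNum q 1 = 1 := by
  simp only [qNum, Real.rpow_one, Real.rpow_neg_one]
  exact div_self (sub_inv_ne_zero hq hq1)

theorem qNum_add (hq : 0 < q) (x y : ℝ) :
    qNum q (x + y) = qNum q x * q ^ y + q ^ (-x) * qNum q y := by
  have h : q ^ (x + y) = q ^ x * q ^ y := Real.rpow_add hq x y
  have h' : q ^ (-(x + y)) = q ^ (-x) * q ^ (-y) := by
    rw [← Real.rpow_add hq]; ring_nf
  simp only [qNum, h, h']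
  ring

theorem qNum_sub (hq : 0 < q) (x y : ℝ) :
    qNum q (x - y) = qNum q x * q ^ (-y) - q ^ (-x) * qNum q y := by
  rw [sub_eq_add_neg, qNum_add hq, qNum_neg]
  ring

/-- The `q`-analogue of `ab = c(a+b-c) + (c-a)(c-b)`. It drives the rank-one commutator formulas and
the coefficient recurrence for `P^U`. -/
theorem qNum_mul_qNum (hq : 0 < q) (a b c : ℝ) :
    qNum q a * qNum q b = qNum q c * qNum q (a + b - c) + qNum q (c - a) * qNum q (c - b) := by
  have e : ∀ x y : ℝ, q ^ (x + y) = q ^ x * q ^ y := Real.rpow_add hq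
  have ea := (Real.rpow_pos_of_pos hq a).ne'
  have eb := (Real.rpow_pos_of_pos hq b).ne'
  have ec := (Real.rpow_pos_of_pos hq c).ne'
  simp only [qNum, neg_sub, Real.rpow_sub hq, e, Real.rpow_neg hq.le]
  -- If the denominator vanishes, all `q`-numbers are `0` by the convention for division by zero.
  by_cases h : q - q⁻¹ = 0
  · simp [h]
  · rw [div_mul_div_comm, div_mul_div_comm, div_mul_div_comm, ← add_div]
    congr 1
    field_simp
    ring

theorem qNum_pos (hq : 0 < q) (hq1 : q ≠ 1) {x : ℝ} (hx : 0 < x) : 0 < qNum q x := by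
  rcases lt_or_gt_of_ne hq1 with h | h
  · have h1 : q ^ x < q ^ (-x) := Real.rpow_lt_rpow_of_exponent_gt hq h (by linarith)
    have h2 : q < q⁻¹ := h.trans ((one_lt_inv₀ hq).2 h)
    exact div_pos_of_neg_of_neg (by linarith) (by linarith)
  · have h1 : q ^ (-x) < q ^ x := Real.rpow_lt_rpow_of_exponent_lt h (by linarith)
    have h2 : q⁻¹ < q := (inv_lt_one_of_one_lt₀ h).trans h
    exact div_pos (by linarith) (by linarith)

theorem qFact_pos (hq : 0 < q) (hq1 : q ≠ 1) (n : ℤ) : 0 < qFact q n :=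
  Finset.prod_pos fun i _ => qNum_pos hq hq1 (by positivity)

@[simp] theorem qFact_zero (q : ℝ) : qFact q 0 = 1 := by simp [qFact]

theorem qFact_succ (q : ℝ) {n : ℤ} (hn : 0 ≤ n) :
    qFact q (n + 1) = qFact q n * qNum q (n + 1) := by
  lift n to ℕ using hn
  have : ((n : ℤ) + 1).toNat = n + 1 := by omega
  simp [qFact, this, Finset.prod_range_succ]

/-- The integer and real arguments enter only through equations, so shifted labels can be matched by
linear arithmetic and cast normalization. -/
theorem qFact_succ_of_eq (q : ℝ) {m n : ℤ} (hn : 0 ≤ n) (h : m = n + 1) {x : ℝ} (hx : x = m) :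
    qFact q m = qFact q n * qNum q x := by
  subst h hx
  rw [qFact_succ q hn]
  push_cast
  rfl

end QNumbers

/-! ### Weights and the rank-one commutation relations. -/

namespace UnitaryRep

variable {q : ℝ} (R : UnitaryRep q V)

/-- `v` is a weight vector with `m₁ - m₂ = x` and `m₂ - m₃ = y`. -/
def HasWeight (v : V) (x y : ℝ) : Prop :=
  ∃ m : Fin 3 → ℝ, v ∈ weightSpace R.A m ∧ m 0 - m 1 = x ∧ m 1 - m 2 = y

variable {R}

theorem mem_weightSpace_iff {v : V} {m : Fin 3 → ℝ} :
    v ∈ weightSpace R.A m ↔ ∀ i, R.A i i v = (m i : ℂ) • v := by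
  simp [weightSpace, Submodule.mem_iInf]

theorem apply_mem_weightSpace {v : V} {m : Fin 3 → ℝ} (hv : v ∈ weightSpace R.A m)
    {j k : Fin 3} (hjk : j ≠ k) :
    R.A j k v ∈ weightSpace R.A
      (fun i => m i + ((if i = j then 1 else 0) - (if i = k then 1 else 0))) := by
  rw [mem_weightSpace_iff] at hv ⊢
  intro i
  have h := congrArg (fun f : Module.End ℂ V => f v) (R.cartan_root i j k hjk)
  simp only [LinearMap.sub_apply, Module.End.mul_apply, LinearMap.smul_apply, hv i,
    map_smul] at h
  rw [sub_eq_iff_eq_add] at h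
  rw [h, ← add_smul]
  congr 1
  push_cast
  split_ifs <;> simp <;> ring

namespace HasWeight

variable {v : V} {x y : ℝ}

theorem congr (h : R.HasWeight v x y) {x' y' : ℝ} (hx : x = x') (hy : y = y') :
    R.HasWeight v x' y' := hx ▸ hy ▸ h

theorem apply_12 (h : R.HasWeight v x y) : R.HasWeight (R.A 0 1 v) (x + 2) (y - 1) := by
  obtain ⟨m, hm, rfl, rfl⟩ := h
  exact ⟨_, apply_mem_weightSpace hm (by decide), by simp; ring, by simp; ring⟩

theorem apply_21 (h : R.HasWeight v x y) : R.HasWeight (R.A 1 0 v) (x - 2) (y + 1) := by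
  obtain ⟨m, hm, rfl, rfl⟩ := h
  exact ⟨_, apply_mem_weightSpace hm (by decide), by simp; ring, by simp; ring⟩

theorem apply_23 (h : R.HasWeight v x y) : R.HasWeight (R.A 1 2 v) (x - 1) (y + 2) := by
  obtain ⟨m, hm, rfl, rfl⟩ := h
  exact ⟨_, apply_mem_weightSpace hm (by decide), by simp; ring, by simp; ring⟩

theorem apply_32 (h : R.HasWeight v x y) : R.HasWeight (R.A 2 1 v) (x + 1) (y - 2) := by
  obtain ⟨m, hm, rfl, rfl⟩ := h
  exact ⟨_, apply_mem_weightSpace hm (by decide), by simp; ring, by simp; ring⟩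

theorem apply_13 (h : R.HasWeight v x y) : R.HasWeight (R.A 0 2 v) (x + 1) (y + 1) := by
  obtain ⟨m, hm, rfl, rfl⟩ := h
  exact ⟨_, apply_mem_weightSpace hm (by decide), by simp; ring, by simp; ring⟩

theorem pow_apply {T : Module.End ℂ V} {a b : ℝ}
    (hT : ∀ {w : V} {x y : ℝ}, R.HasWeight w x y → R.HasWeight (T w) (x + a) (y + b))
    (h : R.HasWeight v x y) (r : ℕ) : R.HasWeight ((T ^ r) v) (x + r * a) (y + r * b) := by
  induction r with
  | zero => simpa using h
  | succ r ih =>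
    rw [pow_succ', Module.End.mul_apply]
    exact (hT ih).congr (by push_cast; ring) (by push_cast; ring)

theorem pow_12 (h : R.HasWeight v x y) (r : ℕ) :
    R.HasWeight ((R.A 0 1 ^ r) v) (x + 2 * r) (y - r) :=
  (pow_apply (a := 2) (b := -1) (fun h => h.apply_12.congr (by ring) (by ring)) h r).congr
    (by ring) (by ring)

theorem pow_21 (h : R.HasWeight v x y) (r : ℕ) :
    R.HasWeight ((R.A 1 0 ^ r) v) (x - 2 * r) (y + r) :=
  (pow_apply (a := -2) (b := 1) (fun h => h.apply_21.congr (by ring) (by ring)) h r).congr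
    (by ring) (by ring)

theorem pow_23 (h : R.HasWeight v x y) (r : ℕ) :
    R.HasWeight ((R.A 1 2 ^ r) v) (x - r) (y + 2 * r) :=
  (pow_apply (a := -1) (b := 2) (fun h => h.apply_23.congr (by ring) (by ring)) h r).congr
    (by ring) (by ring)

theorem pow_32 (h : R.HasWeight v x y) (r : ℕ) :
    R.HasWeight ((R.A 2 1 ^ r) v) (x + r) (y - 2 * r) :=
  (pow_apply (a := 1) (b := -2) (fun h => h.apply_32.congr (by ring) (by ring)) h r).congr
    (by ring) (by ring)

theorem pow_13 (h : R.HasWeight v x y) (r : ℕ) :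
    R.HasWeight ((R.A 0 2 ^ r) v) (x + r) (y + r) :=
  (pow_apply (a := 1) (b := 1) (fun h => h.apply_13.congr (by ring) (by ring)) h r).congr
    (by ring) (by ring)

theorem apply_12_21 (h : R.HasWeight v x y) :
    R.A 0 1 (R.A 1 0 v) = R.A 1 0 (R.A 0 1 v) + (qNum q x : ℂ) • v := by
  obtain ⟨m, hm, rfl, rfl⟩ := h
  have := R.comm_12_21 m v hm
  simp only [LinearMap.sub_apply, Module.End.mul_apply] at this
  rw [← this]; abel

theorem apply_32_23 (h : R.HasWeight v x y) :
    R.A 2 1 (R.A 1 2 v) = R.A 1 2 (R.A 2 1 v) - (qNum q y : ℂ) • v := by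
  obtain ⟨m, hm, rfl, rfl⟩ := h
  have := R.comm_23_32 m v hm
  simp only [LinearMap.sub_apply, Module.End.mul_apply] at this
  rw [← this]; abel

/-- Each further `A_{21}` lowers the weight by 2, and the commutators add up through `[r+1][x-r] +
[x-2(r+1)] = [r+2][x-r-1]`. The companion for `A_{32}`, `A_{23}` is the same with the weight rising.
-/
theorem apply_12_pow_21 (hq : 0 < q) (hq1 : q ≠ 1) (h : R.HasWeight v x y) (r : ℕ) :
    R.A 0 1 ((R.A 1 0 ^ (r + 1)) v) = (R.A 1 0 ^ (r + 1)) (R.A 0 1 v) +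
      ((qNum q (r + 1) * qNum q (x - r) : ℝ) : ℂ) • (R.A 1 0 ^ r) v := by
  induction r with
  | zero => simp [h.apply_12_21, qNum_one hq hq1]
  | succ r ih =>
    rw [pow_succ', Module.End.mul_apply, (h.pow_21 (r + 1)).apply_12_21, ih, map_add, map_smul,
      Module.End.mul_apply, add_assoc, ← Module.End.mul_apply _ (_ ^ r), ← pow_succ', ← add_smul]
    congr 2
    rw [← Complex.ofReal_add]
    congr 1
    have := qNum_mul_qNum hq (r + 1 + 1) (x - (r + 1)) (r + 1)
    rw [show (r + 1 - (r + 1 + 1) : ℝ) = -1 by ring, ← neg_sub (x - _ : ℝ), qNum_neg, qNum_neg,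
      qNum_one hq hq1] at this
    push_cast
    rw [this]
    ring_nf

theorem apply_32_pow_23 (hq : 0 < q) (hq1 : q ≠ 1) (h : R.HasWeight v x y) (r : ℕ) :
    R.A 2 1 ((R.A 1 2 ^ (r + 1)) v) = (R.A 1 2 ^ (r + 1)) (R.A 2 1 v) -
      ((qNum q (r + 1) * qNum q (y + r) : ℝ) : ℂ) • (R.A 1 2 ^ r) v := by
  induction r with
  | zero => simp [h.apply_32_23, qNum_one hq hq1]
  | succ r ih =>
    rw [pow_succ', Module.End.mul_apply, (h.pow_23 (r + 1)).apply_32_23, ih, map_sub, map_smul,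
      Module.End.mul_apply, sub_sub, ← Module.End.mul_apply _ (_ ^ r), ← pow_succ', ← add_smul]
    congr 2
    rw [← Complex.ofReal_add]
    congr 1
    have := qNum_mul_qNum hq (r + 1 + 1) (y + (r + 1)) 1
    rw [qNum_one hq hq1, ← neg_sub _ (1 : ℝ), ← neg_sub _ (1 : ℝ), qNum_neg, qNum_neg] at this
    push_cast
    rw [this]
    ring_nf

end HasWeight

/-! ### Relations involving the composite generators `A_{13}` and `A_{31}`. -/

variable (R)

theorem apply_13 (v : V) :
    R.A 0 2 v = R.A 0 1 (R.A 1 2 v) - (q : ℂ) • R.A 1 2 (R.A 0 1 v) := by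
  simp [R.eq_13]

theorem apply_31 (v : V) :
    R.A 2 0 v = R.A 2 1 (R.A 1 0 v) - (q⁻¹ : ℂ) • R.A 1 0 (R.A 2 1 v) := by
  simp [R.eq_31]

theorem apply_12_32 (v : V) : R.A 0 1 (R.A 2 1 v) = R.A 2 1 (R.A 0 1 v) :=
  congrArg (fun f : Module.End ℂ V => f v) R.comm_12_32

theorem apply_23_21 (v : V) : R.A 1 2 (R.A 1 0 v) = R.A 1 0 (R.A 1 2 v) :=
  congrArg (fun f : Module.End ℂ V => f v) R.comm_23_21

theorem commute_12_32 : Commute (R.A 0 1) (R.A 2 1) := R.comm_12_32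

theorem commute_23_21 : Commute (R.A 1 2) (R.A 1 0) := R.comm_23_21

/-- A `q`-Serre relation in disguise: the cubic expression is exactly `A_{12} A_{13} - q⁻¹ A_{13}
A_{12}`. The next two relations come from other Serre relations in the same way. -/
theorem apply_12_13 (hq : 0 < q) (v : V) :
    R.A 0 1 (R.A 0 2 v) = (q⁻¹ : ℂ) • R.A 0 2 (R.A 0 1 v) := by
  have hq' : (q : ℂ) ≠ 0 := by exact_mod_cast hq.ne'
  have h := congrArg (fun f : Module.End ℂ V => f v) R.serre_12_23
  simp only [LinearMap.sub_apply, LinearMap.add_apply, Module.End.mul_apply, pow_two,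
    LinearMap.smul_apply, LinearMap.zero_apply] at h
  rw [apply_13, apply_13, map_sub, map_smul, smul_sub, smul_smul, inv_mul_cancel₀ hq', one_smul,
    ← sub_eq_zero, ← h]
  push_cast
  module

theorem apply_13_23 (hq : 0 < q) (v : V) :
    R.A 0 2 (R.A 1 2 v) = (q⁻¹ : ℂ) • R.A 1 2 (R.A 0 2 v) := by
  have hq' : (q : ℂ) ≠ 0 := by exact_mod_cast hq.ne'
  have h := congrArg (fun f : Module.End ℂ V => f v) R.serre_23_12
  simp only [LinearMap.sub_apply, LinearMap.add_apply, Module.End.mul_apply, pow_two,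
    LinearMap.smul_apply, LinearMap.zero_apply] at h
  rw [apply_13, apply_13, map_sub, map_smul, smul_sub, smul_smul, inv_mul_cancel₀ hq', one_smul,
    ← sub_eq_zero, ← h]
  push_cast
  module

theorem apply_31_21 (hq : 0 < q) (v : V) :
    R.A 2 0 (R.A 1 0 v) = (q : ℂ) • R.A 1 0 (R.A 2 0 v) := by
  have hq' : (q : ℂ) ≠ 0 := by exact_mod_cast hq.ne'
  have h := congrArg (fun f : Module.End ℂ V => f v) R.serre_21_32
  simp only [LinearMap.sub_apply, LinearMap.add_apply, Module.End.mul_apply, pow_two,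
    LinearMap.smul_apply, LinearMap.zero_apply] at h
  rw [apply_31, apply_31, map_sub, map_smul, smul_sub, smul_smul, mul_inv_cancel₀ hq', one_smul,
    ← sub_eq_zero, ← h]
  push_cast
  module

theorem pow_succ_apply (T : Module.End ℂ V) (k : ℕ) (v : V) :
    (T ^ (k + 1)) v = (T ^ k) (T v) := by
  rw [pow_succ, Module.End.mul_apply]

theorem pow_succ_apply' (T : Module.End ℂ V) (k : ℕ) (v : V) :
    (T ^ (k + 1)) v = T ((T ^ k) v) := by
  rw [pow_succ', Module.End.mul_apply]

/-- Each `A_{23}` that is passed produces an `A_{13}`, which `q`-commutes with the other `A_{23}`.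
The resulting geometric sum is a `q`-number, built up by `[k+2] = q^{k+1} + q⁻¹[k+1]`. -/
theorem apply_12_pow_23 (hq : 0 < q) (hq1 : q ≠ 1) (v : V) (k : ℕ) :
    R.A 0 1 ((R.A 1 2 ^ (k + 1)) v) = ((q ^ (k + 1 : ℝ) : ℝ) : ℂ) • (R.A 1 2 ^ (k + 1)) (R.A 0 1 v)
      + (qNum q (k + 1) : ℂ) • (R.A 1 2 ^ k) (R.A 0 2 v) := by
  induction k generalizing v with
  | zero => simp [apply_13, qNum_one hq hq1]
  | succ k ih =>
    have e : R.A 0 1 (R.A 1 2 v) = R.A 0 2 v + (q : ℂ) • R.A 1 2 (R.A 0 1 v) := by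
      rw [apply_13]; abel
    have h1 : q ^ ((k + 1 : ℕ) + 1 : ℝ) = q ^ (k + 1 : ℝ) * q := by
      rw [Nat.cast_succ, Real.rpow_add_one hq.ne']
    have h2 : qNum q ((k + 1 : ℕ) + 1) = q ^ (k + 1 : ℝ) + q⁻¹ * qNum q (k + 1) := by
      rw [Nat.cast_succ, add_comm (k + 1 : ℝ) 1, qNum_add hq 1, qNum_one hq hq1,
        Real.rpow_neg_one, one_mul]
    rw [pow_succ_apply _ (k + 1) v, ih, apply_13_23 R hq, e, map_add, map_smul, map_smul,
      ← pow_succ_apply (R.A 1 2) (k + 1) (R.A 0 1 v), ← pow_succ_apply (R.A 1 2) k (R.A 0 2 v),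
      h1, h2]
    push_cast
    module

theorem apply_32_pow_21 (hq : 0 < q) (hq1 : q ≠ 1) (v : V) (k : ℕ) :
    R.A 2 1 ((R.A 1 0 ^ (k + 1)) v) =
      ((q ^ (-(k + 1) : ℝ) : ℝ) : ℂ) • (R.A 1 0 ^ (k + 1)) (R.A 2 1 v)
      + (qNum q (k + 1) : ℂ) • (R.A 1 0 ^ k) (R.A 2 0 v) := by
  induction k generalizing v with
  | zero => simp [apply_31, qNum_one hq hq1, Real.rpow_neg_one]
  | succ k ih =>
    have e : R.A 2 1 (R.A 1 0 v) = R.A 2 0 v + (q⁻¹ : ℂ) • R.A 1 0 (R.A 2 1 v) := by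
      rw [apply_31]; abel
    have h1 : q ^ (-((k + 1 : ℕ) + 1) : ℝ) = q ^ (-(k + 1) : ℝ) * q⁻¹ := by
      rw [Nat.cast_succ, neg_add (k + 1 : ℝ), Real.rpow_add hq, Real.rpow_neg_one]
    have h2 : qNum q ((k + 1 : ℕ) + 1) = qNum q (k + 1) * q + q ^ (-(k + 1) : ℝ) := by
      rw [Nat.cast_succ, qNum_add hq (k + 1) 1, qNum_one hq hq1, Real.rpow_one, mul_one]
    rw [pow_succ_apply _ (k + 1) v, ih, apply_31_21 R hq, e, map_add, map_smul, map_smul,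
      ← pow_succ_apply (R.A 1 0) (k + 1) (R.A 2 1 v), ← pow_succ_apply (R.A 1 0) k (R.A 2 0 v),
      h1, h2]
    push_cast
    module

theorem inner_23 (x y : V) : inner ℂ x (R.A 1 2 y) = -inner ℂ (R.A 2 1 x) y := by
  have h := R.adj_23 y x
  rw [← inner_conj_symm x, h, map_neg, inner_conj_symm]

theorem inner_12 (x y : V) : inner ℂ x (R.A 0 1 y) = inner ℂ (R.A 1 0 x) y := by
  rw [← inner_conj_symm x, R.adj_12 y x, inner_conj_symm]

variable {R}

namespace HasWeight

variable {v : V} {x y : ℝ}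

/-- Expanding `A_{13}` leaves two `su_q(2)` commutators at weights `x - 1` and `x`, and `[x-1] -
q[x] = -q^x`. -/
theorem apply_13_21 (hq : 0 < q) (hq1 : q ≠ 1) (h : R.HasWeight v x y) :
    R.A 0 2 (R.A 1 0 v) = R.A 1 0 (R.A 0 2 v) - ((q ^ x : ℝ) : ℂ) • R.A 1 2 v := by
  have e : qNum q (x - 1) - q * qNum q x = -q ^ x := by
    have := qNum_add hq 1 (x - 1)
    rw [add_sub_cancel, qNum_one hq hq1, Real.rpow_neg_one, Real.rpow_sub_one hq.ne'] at this
    rw [this]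
    field_simp
    ring
  rw [R.apply_13, R.apply_23_21, h.apply_23.apply_12_21, h.apply_12_21, R.apply_13, map_sub,
    map_add, map_smul, map_smul, R.apply_23_21]
  have e' := congrArg (fun z : ℝ => (z : ℂ)) e
  push_cast at e' ⊢
  rw [show ((qNum q (x - 1) : ℝ) : ℂ) = q * qNum q x - ((q ^ x : ℝ) : ℂ) by
    linear_combination e']
  module

theorem apply_32_13 (hq : 0 < q) (hq1 : q ≠ 1) (h : R.HasWeight v x y) :
    R.A 2 1 (R.A 0 2 v) = R.A 0 2 (R.A 2 1 v) - ((q ^ (1 - y) : ℝ) : ℂ) • R.A 0 1 v := by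
  have e : qNum q y - q * qNum q (y - 1) = q ^ (1 - y) := by
    have := qNum_add hq (y - 1) 1
    rw [sub_add_cancel, qNum_one hq hq1, Real.rpow_one, neg_sub] at this
    rw [this]
    ring
  rw [R.apply_13, map_sub, map_smul, ← R.apply_12_32, h.apply_32_23, h.apply_12.apply_32_23,
    R.apply_13, map_sub, map_smul, R.apply_12_32]
  have e' := congrArg (fun z : ℝ => (z : ℂ)) e
  push_cast at e' ⊢
  rw [show ((qNum q y : ℝ) : ℂ) = q * qNum q (y - 1) + ((q ^ (1 - y) : ℝ) : ℂ) by
    linear_combination e']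
  module

end HasWeight

theorem apply_12_pow_13 (hq : 0 < q) (l : ℕ) (v : V) :
    R.A 0 1 ((R.A 0 2 ^ l) v) = ((q ^ (-l : ℝ) : ℝ) : ℂ) • (R.A 0 2 ^ l) (R.A 0 1 v) := by
  induction l with
  | zero => simp
  | succ l ih =>
    have h : q ^ (-(l + 1 : ℕ) : ℝ) = q⁻¹ * q ^ (-l : ℝ) := by
      rw [Nat.cast_succ, neg_add_rev, Real.rpow_add hq, Real.rpow_neg_one]
    rw [pow_succ_apply', R.apply_12_13 hq, ih, map_smul, ← pow_succ_apply', smul_smul, h]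
    push_cast
    rfl

namespace HasWeight

variable {v : V} {x y : ℝ}

theorem pow_13_apply_21 (hq : 0 < q) (hq1 : q ≠ 1) (h : R.HasWeight v x y) (l : ℕ) :
    (R.A 0 2 ^ (l + 1)) (R.A 1 0 v) = R.A 1 0 ((R.A 0 2 ^ (l + 1)) v) -
      ((q ^ x * qNum q (l + 1) : ℝ) : ℂ) • R.A 1 2 ((R.A 0 2 ^ l) v) := by
  induction l with
  | zero => simp [h.apply_13_21 hq hq1, qNum_one hq hq1]
  | succ l ih =>
    have e : q ^ x * qNum q ((l + 1 : ℕ) + 1) =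
        q ^ (x + (l + 1 : ℕ)) + q ^ x * qNum q (l + 1) * q⁻¹ := by
      have h2 := qNum_add hq 1 (l + 1)
      rw [qNum_one hq hq1, Real.rpow_neg_one, add_comm] at h2
      rw [Real.rpow_add hq]
      push_cast
      rw [h2]
      ring
    rw [pow_succ_apply', ih, map_sub, map_smul, (h.pow_13 (l + 1)).apply_13_21 hq hq1,
      R.apply_13_23 hq, ← pow_succ_apply', ← pow_succ_apply', e]
    push_cast
    module

theorem apply_32_pow_13 (hq : 0 < q) (hq1 : q ≠ 1) (h : R.HasWeight v x y) (l : ℕ) :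
    R.A 2 1 ((R.A 0 2 ^ (l + 1)) v) = (R.A 0 2 ^ (l + 1)) (R.A 2 1 v) -
      ((q ^ (1 - y - l) * qNum q (l + 1) : ℝ) : ℂ) • (R.A 0 2 ^ l) (R.A 0 1 v) := by
  induction l with
  | zero => simp [h.apply_32_13 hq hq1, qNum_one hq hq1]
  | succ l ih =>
    have e : q ^ (1 - y - (l + 1 : ℕ)) * qNum q ((l + 1 : ℕ) + 1) =
        q ^ (1 - (y + (l + 1 : ℕ))) * q ^ (-(l + 1 : ℕ) : ℝ) + q ^ (1 - y - l) * qNum q (l + 1) := by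
      have h2 := qNum_add hq (l + 1) 1
      rw [qNum_one hq hq1, Real.rpow_one] at h2
      have h3 : (1 - y - l : ℝ) = (1 - y - (l + 1 : ℕ)) + 1 := by push_cast; ring
      have h4 : (1 - (y + (l + 1 : ℕ)) : ℝ) = (1 - y - (l + 1 : ℕ)) := by ring
      rw [h3, h4, Real.rpow_add_one hq.ne']
      push_cast
      rw [h2]
      ring
    rw [pow_succ_apply', (h.pow_13 (l + 1)).apply_32_13 hq hq1, ih, map_sub, map_smul,
      apply_12_pow_13 hq, ← pow_succ_apply', ← pow_succ_apply', e]
    push_cast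
    module

/-- The `A_{12}` produced at each step commutes with `A_{32}`, so only powers of `q` depending on
the weight accumulate. -/
theorem apply_13_pow_32 (hq : 0 < q) (hq1 : q ≠ 1) (h : R.HasWeight v x y) (n : ℕ) :
    R.A 0 2 ((R.A 2 1 ^ (n + 1)) v) = (R.A 2 1 ^ (n + 1)) (R.A 0 2 v) +
      ((q ^ (1 - y + n) * qNum q (n + 1) : ℝ) : ℂ) • (R.A 2 1 ^ n) (R.A 0 1 v) := by
  have key : ∀ {w : V} {x y : ℝ}, R.HasWeight w x y → R.A 0 2 (R.A 2 1 w) =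
      R.A 2 1 (R.A 0 2 w) + ((q ^ (1 - y) : ℝ) : ℂ) • R.A 0 1 w := by
    intro w x y hw
    rw [hw.apply_32_13 hq hq1]
    abel
  induction n with
  | zero => simp [key h, qNum_one hq hq1]
  | succ n ih =>
    have hc : R.A 0 1 ((R.A 2 1 ^ (n + 1)) v) = (R.A 2 1 ^ (n + 1)) (R.A 0 1 v) :=
      congrArg (fun f : Module.End ℂ V => f v) (R.commute_12_32.pow_right (n + 1))
    have e : q ^ (1 - y + (n + 1 : ℕ)) * qNum q ((n + 1 : ℕ) + 1) =
        q ^ (1 - (y - 2 * (n + 1 : ℕ))) + q ^ (1 - y + n) * qNum q (n + 1) := by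
      have h2 := qNum_add hq 1 (n + 1)
      rw [qNum_one hq hq1, Real.rpow_neg_one, add_comm] at h2
      have h3 : q ^ (1 - y + (n + 1 : ℕ)) = q ^ (1 - y + n) * q := by
        rw [← Real.rpow_add_one hq.ne']; push_cast; ring_nf
      have h4 : q ^ (1 - (y - 2 * (n + 1 : ℕ))) = q ^ (1 - y + n) * q * q ^ (n + 1 : ℝ) := by
        rw [← h3, ← Real.rpow_add hq]; push_cast; ring_nf
      rw [h3, h4, Nat.cast_succ, h2]
      field_simp
    rw [pow_succ_apply', key (h.pow_32 (n + 1)), ih, map_add, map_smul, hc,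
      ← pow_succ_apply' _ (n + 1), ← pow_succ_apply' _ n, e]
    push_cast
    module

end HasWeight

/-- `L` is a vector of weight `m` with `m₁ - m₂ = D` and `m₂ - m₃ = F` which is
annihilated by `A_{12}`, `A_{32}` and `A_{31}`. -/
structure IsLowest (R : UnitaryRep q V) (L : V) (D F : ℤ) : Prop where
  weight : R.HasWeight L D F
  ann_12 : R.A 0 1 L = 0
  ann_32 : R.A 2 1 L = 0
  ann_31 : R.A 2 0 L = 0

/-! ### Explicit action on monomials applied to the lowest weight vector. -/

namespace IsLowest

variable {L : V} {D F : ℤ}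

theorem apply_12_pow_13 (h : R.IsLowest L D F) (hq : 0 < q) (l : ℕ) :
    R.A 0 1 ((R.A 0 2 ^ l) L) = 0 := by
  rw [UnitaryRep.apply_12_pow_13 hq, h.ann_12, map_zero, smul_zero]

theorem apply_32_pow_13 (h : R.IsLowest L D F) (hq : 0 < q) (hq1 : q ≠ 1) (l : ℕ) :
    R.A 2 1 ((R.A 0 2 ^ l) L) = 0 := by
  cases l with
  | zero => simp [h.ann_32]
  | succ l => simp [h.weight.apply_32_pow_13 hq hq1, h.ann_32, h.ann_12]

theorem apply_32_pow_21 (h : R.IsLowest L D F) (hq : 0 < q) (hq1 : q ≠ 1) (p : ℕ) :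
    R.A 2 1 ((R.A 1 0 ^ p) L) = 0 := by
  cases p with
  | zero => simp [h.ann_32]
  | succ p => simp [UnitaryRep.apply_32_pow_21 R hq hq1, h.ann_32, h.ann_31]

theorem apply_12_pow_21 (h : R.IsLowest L D F) (hq : 0 < q) (hq1 : q ≠ 1) (p : ℕ) :
    R.A 0 1 ((R.A 1 0 ^ (p + 1)) L) =
      ((qNum q (p + 1) * qNum q (D - p) : ℝ) : ℂ) • (R.A 1 0 ^ p) L := by
  rw [h.weight.apply_12_pow_21 hq hq1, h.ann_12, map_zero, zero_add]

/-- Only `A_{32} A_{21}` survives in `A_{31}`, since `A_{32}` kills `A_{13}^{l+1} L`. Moving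
`A_{21}` inside the power of `A_{13}` leaves two terms whose coefficients combine by the addition
formula into `[D+F+l]`. -/
theorem apply_31_pow_13 (h : R.IsLowest L D F) (hq : 0 < q) (hq1 : q ≠ 1) (l : ℕ) :
    R.A 2 0 ((R.A 0 2 ^ (l + 1)) L) =
      -((qNum q (l + 1) * qNum q (D + F + l) : ℝ) : ℂ) • (R.A 0 2 ^ l) L := by
  have h1 := h.weight.pow_13_apply_21 hq hq1 l
  rw [eq_sub_iff_add_eq] at h1
  have h2 := h.apply_32_pow_21 hq hq1 1
  have h3 := h.apply_12_pow_21 hq hq1 0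
  simp only [pow_one, zero_add, pow_zero, Module.End.one_apply, CharP.cast_eq_zero,
    qNum_one hq hq1, one_mul, sub_zero] at h2 h3
  have e : qNum q (D + F + l) =
      qNum q (F + l) * q ^ (D : ℝ) + q ^ (1 - (F + 1) - l : ℝ) * qNum q D := by
    rw [show (D + F + l : ℝ) = (F + l) + D by ring, qNum_add hq]
    ring_nf
  rw [R.apply_31, h.apply_32_pow_13 hq hq1, map_zero, smul_zero, sub_zero, ← h1, map_add, map_smul,
    h.weight.apply_21.apply_32_pow_13 hq hq1, (h.weight.pow_13 l).apply_32_23,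
    h.apply_32_pow_13 hq hq1, h2, h3, map_zero, map_zero, map_smul, e]
  push_cast
  module

theorem apply_32_pow_21_pow_13 (h : R.IsLowest L D F) (hq : 0 < q) (hq1 : q ≠ 1) (a l : ℕ) :
    R.A 2 1 ((R.A 1 0 ^ (a + 1)) ((R.A 0 2 ^ (l + 1)) L)) =
      -((qNum q (a + 1) * qNum q (l + 1) * qNum q (D + F + l) : ℝ) : ℂ) •
        (R.A 1 0 ^ a) ((R.A 0 2 ^ l) L) := by
  rw [UnitaryRep.apply_32_pow_21 R hq hq1, h.apply_32_pow_13 hq hq1, map_zero, smul_zero,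
    zero_add, h.apply_31_pow_13 hq hq1, map_smul]
  push_cast
  module

theorem apply_12_pow_23_pow_13 (h : R.IsLowest L D F) (hq : 0 < q) (hq1 : q ≠ 1) (k l : ℕ) :
    R.A 0 1 ((R.A 1 2 ^ (k + 1)) ((R.A 0 2 ^ l) L)) =
      (qNum q (k + 1) : ℂ) • (R.A 1 2 ^ k) ((R.A 0 2 ^ (l + 1)) L) := by
  rw [R.apply_12_pow_23 hq hq1, h.apply_12_pow_13 hq, map_zero, smul_zero, zero_add,
    ← pow_succ_apply']

theorem apply_12_pow_13_pow_21 (h : R.IsLowest L D F) (hq : 0 < q) (hq1 : q ≠ 1) (s p : ℕ) :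
    R.A 0 1 ((R.A 0 2 ^ s) ((R.A 1 0 ^ (p + 1)) L)) =
      ((q ^ (-s : ℝ) * (qNum q (p + 1) * qNum q (D - p)) : ℝ) : ℂ) •
        (R.A 0 2 ^ s) ((R.A 1 0 ^ p) L) := by
  rw [UnitaryRep.apply_12_pow_13 hq, h.apply_12_pow_21 hq hq1, map_smul, smul_smul]
  push_cast
  rfl

theorem apply_32_pow_13_pow_21 (h : R.IsLowest L D F) (hq : 0 < q) (hq1 : q ≠ 1) (s p : ℕ) :
    R.A 2 1 ((R.A 0 2 ^ (s + 1)) ((R.A 1 0 ^ (p + 1)) L)) =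
      -((q ^ (-(F + p + s) : ℝ) * qNum q (s + 1) * (qNum q (p + 1) * qNum q (D - p)) : ℝ) : ℂ) •
        (R.A 0 2 ^ s) ((R.A 1 0 ^ p) L) := by
  have e : (-(F + p + s) : ℝ) = 1 - (F + (p + 1 : ℕ)) - s := by push_cast; ring
  rw [(h.weight.pow_21 (p + 1)).apply_32_pow_13 hq hq1, h.apply_32_pow_21 hq hq1, map_zero,
    h.apply_12_pow_21 hq hq1, map_smul, e]
  push_cast
  module

/-- Each `A_{32}` uses up one `A_{13}` and one `A_{21}`, and kills the vector once either is
exhausted. -/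
theorem pow_32_pow_13_pow_21_eq_zero (h : R.IsLowest L D F) (hq : 0 < q) (hq1 : q ≠ 1)
    (s p r : ℕ) (hr : p < r) :
    (R.A 2 1 ^ r) ((R.A 0 2 ^ s) ((R.A 1 0 ^ p) L)) = 0 := by
  induction r generalizing s p with
  | zero => omega
  | succ r ih =>
    rw [pow_succ_apply]
    rcases s with - | s
    · simp [h.apply_32_pow_21 hq hq1]
    rcases p with - | p
    · have := h.apply_32_pow_13 hq hq1 (s + 1)
      simp only [pow_zero, Module.End.one_apply]
      rw [this, map_zero]
    · rw [h.apply_32_pow_13_pow_21 hq hq1, map_smul, ih s p (by omega), smul_zero]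

/-- Moving `A_{13}` inward gives two multiples of the same vector, one from the enlarged power of
`A_{13}` and one from the commutator `A_{12}`. Their coefficients combine by the subtraction formula
for `[(s+1)-(r+1)]`. -/
theorem apply_13_pow_32_pow_13_pow_21 (h : R.IsLowest L D F) (hq : 0 < q) (hq1 : q ≠ 1)
    (s p r : ℕ) :
    R.A 0 2 ((R.A 2 1 ^ (r + 1)) ((R.A 0 2 ^ s) ((R.A 1 0 ^ (p + 1)) L))) =
      -((q ^ (r - (F + p + s - 1) : ℝ) * qNum q (s - r) * (qNum q (p + 1) * qNum q (D - p)) : ℝ) :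
        ℂ) • (R.A 2 1 ^ r) ((R.A 0 2 ^ s) ((R.A 1 0 ^ p) L)) := by
  have e : q ^ (r - (F + p + s - 1) : ℝ) * qNum q (s - r) =
      q ^ (-(F + p + s) : ℝ) * qNum q (s + 1) -
        q ^ (1 - (F + (p + 1 : ℕ) + s) + r : ℝ) * qNum q (r + 1) * q ^ (-s : ℝ) := by
    have h1 : q ^ (r - (F + p + s - 1) : ℝ) = q ^ (-(F + p + s) : ℝ) * (q ^ (r : ℝ) * q) := by
      rw [← Real.rpow_add_one hq.ne', ← Real.rpow_add hq]; ring_nf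
    have h2 : q ^ (1 - (F + (p + 1 : ℕ) + s) + r : ℝ) = q ^ (-(F + p + s) : ℝ) * q ^ (r : ℝ) := by
      rw [← Real.rpow_add hq]; push_cast; ring_nf
    have h3 := qNum_sub hq (s + 1) (r + 1)
    rw [show (s + 1 - (r + 1) : ℝ) = s - r by ring] at h3
    rw [h1, h2, h3, Real.rpow_neg hq.le (r + 1 : ℝ),
      Real.rpow_neg hq.le (s + 1 : ℝ), Real.rpow_neg hq.le (s : ℝ),
      Real.rpow_add_one hq.ne', Real.rpow_add_one hq.ne']
    have := (Real.rpow_pos_of_pos hq r).ne'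
    have := (Real.rpow_pos_of_pos hq s).ne'
    field_simp
  rw [((h.weight.pow_21 (p + 1)).pow_13 s).apply_13_pow_32 hq hq1, ← pow_succ_apply',
    pow_succ_apply _ r, h.apply_32_pow_13_pow_21 hq hq1, h.apply_12_pow_13_pow_21 hq hq1, map_smul,
    map_smul, e]
  push_cast
  module

end IsLowest

end UnitaryRep

/-! ### The projection `P^U` and its interaction with `A_{32}`. -/

/-- The coefficients of the projection operator `P^U`, with `n = 2U`. -/
noncomputable def projUCoeff (q : ℝ) (n : ℤ) (r : ℕ) : ℝ :=
  (-1) ^ r * qFact q (n + 1) / (qFact q r * qFact q (n + r + 1))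

theorem projUCoeff_succ {q : ℝ} (hq : 0 < q) (hq1 : q ≠ 1) {n : ℤ} (hn : 0 ≤ n) (r : ℕ) :
    projUCoeff q n (r + 1) * (qNum q (r + 1) * qNum q (n + r + 2)) = -projUCoeff q n r := by
  have h1 : qFact q ((r + 1 : ℕ) : ℤ) = qFact q r * qNum q (r + 1) :=
    qFact_succ_of_eq q (by omega) (by push_cast; ring) (by push_cast; ring)
  have h2 : qFact q (n + (r + 1 : ℕ) + 1) = qFact q (n + r + 1) * qNum q (n + r + 2) :=
    qFact_succ_of_eq q (by omega) (by push_cast; ring) (by push_cast; ring)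
  have hn' : (0 : ℝ) ≤ n := by exact_mod_cast hn
  have := (qNum_pos hq hq1 (x := (r : ℝ) + 1) (by positivity)).ne'
  have := (qNum_pos hq hq1 (x := (n : ℝ) + r + 2) (by positivity)).ne'
  have := (qFact_pos hq hq1 r).ne'
  have := (qFact_pos hq hq1 (n + r + 1)).ne'
  rw [projUCoeff, projUCoeff, h1, h2, pow_succ]
  field_simp

theorem projUCoeff_zero {q : ℝ} (hq : 0 < q) (hq1 : q ≠ 1) (n : ℤ) : projUCoeff q n 0 = 1 := by
  simp [projUCoeff, (qFact_pos hq hq1 (n + 1)).ne']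

namespace UnitaryRep

variable {q : ℝ} {R : UnitaryRep q V}

theorem pow_apply_eq_zero_of_le {T : Module.End ℂ V} {v : V} {N : ℕ} (h : (T ^ N) v = 0) {r : ℕ}
    (hr : N ≤ r) : (T ^ r) v = 0 := by
  obtain ⟨m, rfl⟩ := Nat.exists_eq_add_of_le' hr
  rw [pow_add, Module.End.mul_apply, h, map_zero]

theorem projU_eq_sum {v : V} {N : ℕ} (hv : (R.A 0 1 ^ N) v = 0) (n : ℤ) :
    R.projU n v = ∑ r ∈ Finset.range N,
      (projUCoeff q n r : ℂ) • (R.A 1 0 ^ r) ((R.A 0 1 ^ r) v) := by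
  apply finsum_eq_sum_of_support_subset
  intro r hr
  by_contra h
  apply hr
  rw [Finset.coe_range, Set.mem_Iio, not_lt] at h
  simp [pow_apply_eq_zero_of_le hv h]

/-- The correction lies in the image of `A_{21}`, hence is orthogonal to vectors killed by `A_{12}`.
This replaces any appeal to idempotence or self-adjointness of `P^U`. -/
theorem exists_projU_eq_add (hq : 0 < q) (hq1 : q ≠ 1) {v : V} {N : ℕ}
    (hv : (R.A 0 1 ^ (N + 1)) v = 0) (n : ℤ) :
    ∃ w, R.projU n v = v + R.A 1 0 w := by
  refine ⟨∑ r ∈ Finset.range N,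
    (projUCoeff q n (r + 1) : ℂ) • (R.A 1 0 ^ r) ((R.A 0 1 ^ (r + 1)) v), ?_⟩
  rw [projU_eq_sum hv, Finset.sum_range_succ', map_sum, add_comm, projUCoeff_zero hq hq1]
  simp [pow_succ_apply']

/-- The coefficient recurrence makes the commutator part of each term cancel its predecessor; the
last term dies by nilpotency. -/
theorem apply_12_projU (hq : 0 < q) (hq1 : q ≠ 1) {v : V} {N : ℕ}
    (hv : (R.A 0 1 ^ (N + 1)) v = 0) {n : ℤ} (hn : 0 ≤ n) {y : ℝ} (hw : R.HasWeight v n y) :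
    R.A 0 1 (R.projU n v) = 0 := by
  have key : ∀ r ∈ Finset.range N,
      R.A 0 1 ((projUCoeff q n (r + 1) : ℂ) • (R.A 1 0 ^ (r + 1)) ((R.A 0 1 ^ (r + 1)) v)) =
      (projUCoeff q n (r + 1) : ℂ) • (R.A 1 0 ^ (r + 1)) ((R.A 0 1 ^ (r + 2)) v) -
        (projUCoeff q n r : ℂ) • (R.A 1 0 ^ r) ((R.A 0 1 ^ (r + 1)) v) := by
    intro r _
    have e := projUCoeff_succ hq hq1 hn r
    have e2 : (n + 2 * (r + 1 : ℕ) - r : ℝ) = n + r + 2 := by push_cast; ring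
    rw [map_smul, (hw.pow_12 (r + 1)).apply_12_pow_21 hq hq1, ← pow_succ_apply', e2,
      (neg_eq_iff_eq_neg.2 e).symm]
    push_cast
    module
  rw [projU_eq_sum hv, Finset.sum_range_succ', map_add, map_sum, Finset.sum_congr rfl key,
    Finset.sum_range_sub
      (fun r => (projUCoeff q n r : ℂ) • (R.A 1 0 ^ r) ((R.A 0 1 ^ (r + 1)) v)), hv]
  simp

theorem apply_32_pow_23 (hq : 0 < q) (hq1 : q ≠ 1) {v : V} {x y : ℝ} (h : R.HasWeight v x y)
    (m : ℕ) :
    R.A 2 1 ((R.A 1 2 ^ m) v) = (R.A 1 2 ^ m) (R.A 2 1 v) -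
      ((qNum q m * qNum q (y + m - 1) : ℝ) : ℂ) • (R.A 1 2 ^ (m - 1)) v := by
  cases m with
  | zero => simp
  | succ m =>
    rw [h.apply_32_pow_23 hq hq1]
    simp [← add_assoc]

theorem pow_21_pow_23 (a b : ℕ) (v : V) :
    (R.A 1 0 ^ a) ((R.A 1 2 ^ b) v) = (R.A 1 2 ^ b) ((R.A 1 0 ^ a) v) :=
  congrArg (fun f : Module.End ℂ V => f v) (R.commute_23_21.symm.pow_pow a b)

namespace IsLowest

variable {L : V} {D F : ℤ}

/-- On powers of `A_{13}` over `L` the outer `A_{13}` acts as `A_{12} A_{23}`, whose adjoint is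
`-A_{32} A_{21}`; that sign makes the norm positive. -/
theorem inner_pow_13 (h : R.IsLowest L D F) (hq : 0 < q) (hq1 : q ≠ 1) (l : ℕ) :
    inner ℂ ((R.A 0 2 ^ (l + 1)) L) ((R.A 0 2 ^ (l + 1)) L) =
      ((qNum q (l + 1) * qNum q (D + F + l) : ℝ) : ℂ) *
        inner ℂ ((R.A 0 2 ^ l) L) ((R.A 0 2 ^ l) L) := by
  have e := h.apply_32_pow_21_pow_13 hq hq1 0 l
  rw [zero_add, pow_one, pow_zero, Module.End.one_apply] at e
  nth_rewrite 1 [pow_succ_apply']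
  rw [R.apply_13, h.apply_12_pow_13 hq, map_zero, smul_zero, sub_zero, R.adj_12, R.adj_23, e,
    inner_smul_right]
  simp [qNum_one hq hq1]

theorem inner_pow_13_eq (h : R.IsLowest L D F) (hq : 0 < q) (hq1 : q ≠ 1)
    (hL : inner ℂ L L = 1) (hDF : 1 ≤ D + F) (l : ℕ) :
    inner ℂ ((R.A 0 2 ^ l) L) ((R.A 0 2 ^ l) L) =
      ((qFact q l * qFact q (D + F + l - 1) / qFact q (D + F - 1) : ℝ) : ℂ) := by
  have h0 := (qFact_pos hq hq1 (D + F - 1)).ne'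
  induction l with
  | zero =>
    simp only [pow_zero, Module.End.one_apply]
    rw [hL]
    simp [h0]
  | succ l ih =>
    have h1 : qFact q ((l + 1 : ℕ) : ℤ) = qFact q l * qNum q (l + 1) :=
      qFact_succ_of_eq q (by omega) (by push_cast; ring) (by push_cast; ring)
    have h2 : qFact q (D + F + (l + 1 : ℕ) - 1) = qFact q (D + F + l - 1) * qNum q (D + F + l) :=
      qFact_succ_of_eq q (by omega) (by push_cast; ring) (by push_cast; ring)
    rw [h.inner_pow_13 hq hq1, ih, h1, h2, ← Complex.ofReal_mul]
    congr 1
    ring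

theorem pow_12_pow_23_pow_13 (h : R.IsLowest L D F) (hq : 0 < q) (hq1 : q ≠ 1) (k l r : ℕ)
    (hr : r ≤ k) :
    (R.A 0 1 ^ r) ((R.A 1 2 ^ k) ((R.A 0 2 ^ l) L)) =
      ((qFact q k / qFact q (k - r : ℕ) : ℝ) : ℂ) •
        (R.A 1 2 ^ (k - r)) ((R.A 0 2 ^ (l + r)) L) := by
  induction r with
  | zero => simp [(qFact_pos hq hq1 k).ne']
  | succ r ih =>
    obtain ⟨j, rfl⟩ := Nat.exists_eq_add_of_le hr
    have h1 : r + 1 + j - r = j + 1 := by omega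
    have h2 : r + 1 + j - (r + 1) = j := by omega
    have h3 : qFact q ((j + 1 : ℕ) : ℤ) = qFact q j * qNum q (j + 1) :=
      qFact_succ_of_eq q (by omega) (by push_cast; ring) (by push_cast; ring)
    have h4 : qNum q ((j : ℝ) + 1) ≠ 0 := (qNum_pos hq hq1 (by positivity)).ne'
    have h5 := (qFact_pos hq hq1 j).ne'
    rw [pow_succ_apply', ih (by omega), map_smul, h1, h2, h.apply_12_pow_23_pow_13 hq hq1,
      smul_smul, h3, ← Complex.ofReal_mul, add_assoc]
    congr 2
    field_simp

theorem pow_12_pow_23_pow_13_eq_zero (h : R.IsLowest L D F) (hq : 0 < q) (hq1 : q ≠ 1)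
    (k l : ℕ) : (R.A 0 1 ^ (k + 1)) ((R.A 1 2 ^ k) ((R.A 0 2 ^ l) L)) = 0 := by
  rw [pow_succ_apply', h.pow_12_pow_23_pow_13 hq hq1 k l k le_rfl, map_smul, Nat.sub_self,
    pow_zero, Module.End.one_apply, h.apply_12_pow_13 hq, smul_zero]

/-- The vector `A_{23}^k A_{13}^ℓ |L⟩` has weight `2U = D - k + ℓ` for the first `su_q(2)`. -/
theorem hasWeight_pow_23_pow_13 (h : R.IsLowest L D F) (k l : ℕ) :
    R.HasWeight ((R.A 1 2 ^ k) ((R.A 0 2 ^ l) L)) ((D - k + l : ℤ) : ℝ) (F + l + 2 * k) :=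
  ((h.weight.pow_13 l).pow_23 k).congr (by push_cast; ring) rfl

theorem projU_pow_23_pow_13 (h : R.IsLowest L D F) (hq : 0 < q) (hq1 : q ≠ 1) (n : ℤ) (k l : ℕ) :
    R.projU n ((R.A 1 2 ^ k) ((R.A 0 2 ^ l) L)) = ∑ r ∈ Finset.range (k + 1),
      ((projUCoeff q n r * (qFact q k / qFact q (k - r : ℕ)) : ℝ) : ℂ) •
        (R.A 1 2 ^ (k - r)) ((R.A 1 0 ^ r) ((R.A 0 2 ^ (l + r)) L)) := by
  rw [projU_eq_sum (h.pow_12_pow_23_pow_13_eq_zero hq hq1 k l)]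
  refine Finset.sum_congr rfl fun r hr => ?_
  rw [h.pow_12_pow_23_pow_13 hq hq1 k l r (Finset.mem_range_succ_iff.1 hr), map_smul, smul_smul,
    pow_21_pow_23, Complex.ofReal_mul]

end IsLowest

/-- The coefficient comparison behind `apply_32_projU`. With the common factorials removed, it is
`qNum_mul_qNum` with `c = D + F + l + r`. -/
theorem projUCoeff_recurrence (hq : 0 < q) (hq1 : q ≠ 1) {D F : ℤ} {k : ℕ} (l : ℕ)
    (hk : ((k + 1 : ℕ) : ℤ) ≤ D) {r : ℕ} (hr : r ≤ k) :
    projUCoeff q (D - (k + 1 : ℕ) + l) r * (qFact q (k + 1 : ℕ) / qFact q (k + 1 - r : ℕ)) *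
        (qNum q (k + 1 - r : ℕ) * qNum q (F + l + r + k)) +
      projUCoeff q (D - (k + 1 : ℕ) + l) (r + 1) *
        (qFact q (k + 1 : ℕ) / qFact q (k + 1 - (r + 1) : ℕ)) *
        (qNum q (r + 1) * qNum q (l + r + 1) * qNum q (D + F + l + r)) =
      qNum q (k + 1) * qNum q (D - k) * qNum q (F + k - 1) / qNum q (D - k + l + 1) *
        (projUCoeff q (D - k + l) r * (qFact q k / qFact q (k - r : ℕ))) := by
  obtain ⟨j, rfl⟩ := Nat.exists_eq_add_of_le hr
  have e1 : r + j + 1 - r = j + 1 := by omega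
  have e2 : r + j + 1 - (r + 1) = j := by omega
  have e3 : r + j - r = j := by omega
  have hD : ((r + j + 1 : ℕ) : ℝ) ≤ D := by exact_mod_cast hk
  push_cast at hD
  have h1 : qFact q ((r + j + 1 : ℕ) : ℤ) = qFact q (r + j : ℕ) * qNum q (r + j + 1) :=
    qFact_succ_of_eq q (by omega) (by push_cast; ring) (by push_cast; ring)
  have h2 : qFact q ((j + 1 : ℕ) : ℤ) = qFact q j * qNum q (j + 1) :=
    qFact_succ_of_eq q (by omega) (by push_cast; ring) (by push_cast; ring)
  have h3 : qFact q ((r + 1 : ℕ) : ℤ) = qFact q r * qNum q (r + 1) :=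
    qFact_succ_of_eq q (by omega) (by push_cast; ring) (by push_cast; ring)
  have h4 : qFact q (D - (r + j + 1 : ℕ) + l + (r + 1 : ℕ) + 1) =
      qFact q (D - j + l) * qNum q (D - j + l + 1) :=
    qFact_succ_of_eq q (by omega) (by push_cast; ring) (by push_cast; ring)
  have h5 : qFact q (D - (r + j : ℕ) + l + r + 1) =
      qFact q (D - j + l) * qNum q (D - j + l + 1) :=
    qFact_succ_of_eq q (by omega) (by push_cast; ring) (by push_cast; ring)
  have h6 : qFact q (D - (r + j + 1 : ℕ) + l + r + 1) = qFact q (D - j + l) := by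
    congr 1; push_cast; ring
  have h7 : qFact q (D - (r + j : ℕ) + l + 1) =
      qFact q (D - (r + j + 1 : ℕ) + l + 1) * qNum q (D - (r + j : ℕ) + l + 1) :=
    qFact_succ_of_eq q (by omega) (by push_cast; ring) (by push_cast; ring)
  have key := qNum_mul_qNum hq (F + l + r + (r + j : ℕ)) (D - j + l + 1) (D + F + l + r)
  rw [show (D + F + l + r - (F + l + r + (r + j : ℕ)) : ℝ) = D - (r + j : ℕ) by ring,
    show (D + F + l + r - (D - j + l + 1) : ℝ) = F + (r + j : ℕ) - 1 by push_cast; ring,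
    show (F + l + r + (r + j : ℕ) + (D - j + l + 1) - (D + F + l + r) : ℝ) = l + r + 1 by
      push_cast; ring] at key
  have := (qNum_pos hq hq1 (x := (r : ℝ) + 1) (by positivity)).ne'
  have := (qNum_pos hq hq1 (x := (j : ℝ) + 1) (by positivity)).ne'
  have : qNum q (D - j + l + 1) ≠ 0 := (qNum_pos hq hq1 (by
    have : (0 : ℝ) ≤ r := by positivity
    have : (0 : ℝ) ≤ l := by positivity
    linarith)).ne'
  have : qNum q (D - (r + j : ℕ) + l + 1) ≠ 0 := (qNum_pos hq hq1 (by
    have : (0 : ℝ) ≤ l := by positivity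
    push_cast
    linarith)).ne'
  have := (qFact_pos hq hq1 r).ne'
  have := (qFact_pos hq hq1 j).ne'
  have := (qFact_pos hq hq1 (D - j + l)).ne'
  simp only [projUCoeff, e1, e2, e3, h1, h2, h3, h4, h5, h6, h7, pow_succ]
  rw [show ((j + 1 : ℕ) : ℝ) = j + 1 by push_cast; ring,
    show ((r + j : ℕ) : ℝ) + 1 = r + j + 1 by push_cast; ring]
  field_simp
  linear_combination qFact q (D - (r + j + 1 : ℕ) + l + 1) * qFact q (r + j : ℕ) *
    qNum q (r + j + 1) * key

namespace IsLowest

variable {L : V} {D F : ℤ}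

/-- `A_{32}` commutes with `A_{12}`, so it preserves the vectors killed by `A_{12}`. The scalar is
found by comparing coefficients of `A_{23}^{k-r} A_{21}^r A_{13}^{l+r} L`: term `r` contributes when
`A_{32}` meets `A_{23}`, term `r + 1` when it meets `A_{21}` and `A_{13}`. -/
theorem apply_32_projU (h : R.IsLowest L D F) (hq : 0 < q) (hq1 : q ≠ 1) (k l : ℕ)
    (hk : ((k + 1 : ℕ) : ℤ) ≤ D) :
    R.A 2 1 (R.projU (D - (k + 1 : ℕ) + l) ((R.A 1 2 ^ (k + 1)) ((R.A 0 2 ^ l) L))) =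
      -((qNum q (k + 1) * qNum q (D - k) * qNum q (F + k - 1) / qNum q (D - k + l + 1) : ℝ) : ℂ) •
        R.projU (D - k + l) ((R.A 1 2 ^ k) ((R.A 0 2 ^ l) L)) := by
  rw [h.projU_pow_23_pow_13 hq hq1, h.projU_pow_23_pow_13 hq hq1, map_sum, Finset.smul_sum]
  have step : ∀ r : ℕ, R.A 2 1 ((R.A 1 2 ^ (k + 1 - r))
        ((R.A 1 0 ^ r) ((R.A 0 2 ^ (l + r)) L))) =
      (R.A 1 2 ^ (k + 1 - r)) (R.A 2 1 ((R.A 1 0 ^ r) ((R.A 0 2 ^ (l + r)) L))) -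
      ((qNum q (k + 1 - r : ℕ) * qNum q (F + l + 2 * r + (k + 1 - r : ℕ) - 1) : ℝ) : ℂ) •
        (R.A 1 2 ^ (k - r)) ((R.A 1 0 ^ r) ((R.A 0 2 ^ (l + r)) L)) := by
    intro r
    rw [apply_32_pow_23 hq hq1 ((h.weight.pow_13 (l + r)).pow_21 r),
      show k + 1 - r - 1 = k - r by omega]
    congr 5
    push_cast
    ring
  simp only [map_smul, step, smul_sub]
  -- The two boundary terms vanish, one because `A_{32}` kills `A_{13}^l L`, the other because `[0]
  -- = 0`. This aligns the indices.
  rw [Finset.sum_sub_distrib, Finset.sum_range_succ', Finset.sum_range_succ _ (k + 1)]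
  simp only [pow_zero, Module.End.one_apply, add_zero, h.apply_32_pow_13 hq hq1, Nat.sub_self,
    Nat.cast_zero, qNum_zero, zero_mul, Complex.ofReal_zero, zero_smul, smul_zero, map_zero,
    ← Finset.sum_sub_distrib]
  refine Finset.sum_congr rfl fun r hr => ?_
  rw [Finset.mem_range_succ_iff] at hr
  have e := projUCoeff_recurrence hq hq1 (F := F) l hk hr
  have e1 : (F + l + 2 * r + (k + 1 - r : ℕ) - 1 : ℝ) = F + l + r + k := by
    rw [Nat.cast_sub (by omega)]; push_cast; ring
  refine Eq.trans ?_ ((congrArg (fun z : ℝ => -(z : ℂ) • (R.A 1 2 ^ (k - r))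
    ((R.A 1 0 ^ r) ((R.A 0 2 ^ (l + r)) L))) e).trans (by push_cast; module))
  rw [← add_assoc l r 1, h.apply_32_pow_21_pow_13 hq hq1, map_smul, e1, Nat.add_sub_add_right]
  push_cast
  rw [← add_assoc (D + F : ℝ)]
  module

end IsLowest

end UnitaryRep

/-! ### The projection `P^T` and its interaction with `A_{12}`. -/

/-- The coefficients of the projection operator `P^T`, with `n = 2T`. -/
noncomputable def projTCoeff (q : ℝ) (n : ℤ) (r : ℕ) : ℝ :=
  qFact q (n - r) / (qFact q r * qFact q n)

theorem projTCoeff_succ {q : ℝ} (hq : 0 < q) (hq1 : q ≠ 1) {n : ℤ} {r : ℕ} (hr : (r : ℤ) < n) :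
    projTCoeff q n (r + 1) * (qNum q (r + 1) * qNum q (n - r)) = projTCoeff q n r := by
  have h1 : qFact q ((r + 1 : ℕ) : ℤ) = qFact q r * qNum q (r + 1) :=
    qFact_succ_of_eq q (by omega) (by push_cast; ring) (by push_cast; ring)
  have h2 : qFact q (n - r) = qFact q (n - (r + 1 : ℕ)) * qNum q (n - r) :=
    qFact_succ_of_eq q (by omega) (by push_cast; ring) (by push_cast; ring)
  have := (qNum_pos hq hq1 (x := (r : ℝ) + 1) (by positivity)).ne'
  have := (qFact_pos hq hq1 r).ne'
  have := (qFact_pos hq hq1 n).ne'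
  rw [projTCoeff, projTCoeff, h1, h2]
  field_simp

theorem projTCoeff_zero {q : ℝ} (hq : 0 < q) (hq1 : q ≠ 1) (n : ℤ) : projTCoeff q n 0 = 1 := by
  simp [projTCoeff, (qFact_pos hq hq1 n).ne']

/-- This is the subtraction formula for the splitting `N + 1 - s = (N + 1 - r) - (s - r)`. -/
theorem projTCoeff_recurrence {q : ℝ} (hq : 0 < q) (hq1 : q ≠ 1) {N r : ℕ} (hr : r ≤ N) (s : ℝ) :
    projTCoeff q (N + 1 : ℕ) r * (q ^ (r : ℝ) * q ^ (-s)) -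
      projTCoeff q (N + 1 : ℕ) (r + 1) *
        (qNum q (r + 1) * (q ^ (r - (N + 1) : ℝ) * qNum q (s - r))) =
      qNum q (N + 1 - s) / qNum q (N + 1) * projTCoeff q N r := by
  have hr' : (r : ℝ) ≤ N := by exact_mod_cast hr
  have h0 := (qNum_pos hq hq1 (x := (N : ℝ) + 1 - r) (by linarith)).ne'
  have h1 := (qNum_pos hq hq1 (x := (N : ℝ) + 1) (by positivity)).ne'
  have h2 := (qNum_pos hq hq1 (x := (r : ℝ) + 1) (by positivity)).ne'
  have e1 := projTCoeff_succ hq hq1 (n := (N + 1 : ℕ)) (r := r) (by omega)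
  push_cast at e1
  have h3 : qFact q ((N + 1 : ℕ) : ℤ) = qFact q N * qNum q (N + 1) :=
    qFact_succ_of_eq q (by omega) (by push_cast; ring) (by push_cast; ring)
  have h4 : qFact q ((N + 1 : ℕ) - r : ℤ) = qFact q (N - r) * qNum q (N + 1 - r) :=
    qFact_succ_of_eq q (by omega) (by push_cast; ring) (by push_cast; ring)
  have e2 : projTCoeff q N r =
      projTCoeff q (N + 1 : ℕ) r * qNum q (N + 1) / qNum q (N + 1 - r) := by
    have := (qFact_pos hq hq1 r).ne'
    have := (qFact_pos hq hq1 N).ne'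
    rw [projTCoeff, projTCoeff, h3, h4]
    field_simp
  have e3 := qNum_sub hq (N + 1 - r) (s - r)
  have e4 : q ^ (-(s - r)) = q ^ (r : ℝ) * q ^ (-s) := by
    rw [← Real.rpow_add hq]; ring_nf
  rw [show (N + 1 - r - (s - r) : ℝ) = N + 1 - s by ring, e4, neg_sub] at e3
  rw [e2, e3]
  push_cast
  field_simp
  linear_combination (-q ^ (r - (N + 1) : ℝ) * qNum q (s - r)) * e1

namespace UnitaryRep

variable {q : ℝ} {R : UnitaryRep q V}

theorem projT_natCast (N : ℕ) (v : V) :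
    R.projT N v = ∑ r ∈ Finset.range (N + 1),
      (projTCoeff q N r : ℂ) • (R.A 1 2 ^ r) ((R.A 2 1 ^ r) v) := rfl

theorem exists_projT_eq_add (hq : 0 < q) (hq1 : q ≠ 1) (n : ℤ) (v : V) :
    ∃ w, R.projT n v = v + R.A 1 2 w := by
  refine ⟨∑ r ∈ Finset.range n.toNat,
    (projTCoeff q n (r + 1) : ℂ) • (R.A 1 2 ^ r) ((R.A 2 1 ^ (r + 1)) v), ?_⟩
  change ∑ r ∈ Finset.range (n.toNat + 1),
    (projTCoeff q n r : ℂ) • (R.A 1 2 ^ r) ((R.A 2 1 ^ r) v) = _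
  rw [Finset.sum_range_succ', map_sum, add_comm, projTCoeff_zero hq hq1]
  simp [pow_succ_apply']

theorem apply_32_projT (hq : 0 < q) (hq1 : q ≠ 1) {v : V} {N : ℕ}
    (hv : (R.A 2 1 ^ (N + 1)) v = 0) {x : ℝ} (hw : R.HasWeight v x (N + 2)) :
    R.A 2 1 (R.projT N v) = 0 := by
  have key : ∀ r ∈ Finset.range N,
      R.A 2 1 ((projTCoeff q N (r + 1) : ℂ) • (R.A 1 2 ^ (r + 1)) ((R.A 2 1 ^ (r + 1)) v)) =
      (projTCoeff q N (r + 1) : ℂ) • (R.A 1 2 ^ (r + 1)) ((R.A 2 1 ^ (r + 2)) v) -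
        (projTCoeff q N r : ℂ) • (R.A 1 2 ^ r) ((R.A 2 1 ^ (r + 1)) v) := by
    intro r hr
    have e := projTCoeff_succ hq hq1 (n := N) (r := r) (by exact_mod_cast Finset.mem_range.1 hr)
    have e2 : (N + 2 - 2 * (r + 1 : ℕ) + r : ℝ) = (N : ℤ) - r := by push_cast; ring
    rw [map_smul, (hw.pow_32 (r + 1)).apply_32_pow_23 hq hq1, ← pow_succ_apply', e2, ← e]
    push_cast
    module
  rw [projT_natCast, Finset.sum_range_succ', map_add, map_sum, Finset.sum_congr rfl key,
    Finset.sum_range_sub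
      (fun r => (projTCoeff q N r : ℂ) • (R.A 1 2 ^ r) ((R.A 2 1 ^ (r + 1)) v)), hv]
  simp

namespace IsLowest

variable {L : V} {D F : ℤ}

/-- The counterpart of `apply_32_projU`: `A_{12}` commutes with the inner powers of `A_{32}` but
turns an outer `A_{23}` into `A_{13}`, so terms `r` and `r + 1` feed the same vector. -/
theorem apply_12_projT (h : R.IsLowest L D F) (hq : 0 < q) (hq1 : q ≠ 1) (s p N : ℕ)
    (hN : (N : ℤ) = F + p + s - 2) (hF : 2 ≤ F) :
    R.A 0 1 (R.projT (N + 1 : ℕ) ((R.A 0 2 ^ s) ((R.A 1 0 ^ (p + 1)) L))) =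
      ((qNum q (p + 1) * qNum q (D - p) * (qNum q (N + 1 - s) / qNum q (N + 1)) : ℝ) : ℂ) •
        R.projT N ((R.A 0 2 ^ s) ((R.A 1 0 ^ p) L)) := by
  have hN' : (N : ℝ) = F + p + s - 2 := by exact_mod_cast hN
  set y := (R.A 0 2 ^ s) ((R.A 1 0 ^ (p + 1)) L) with hy
  set y' := (R.A 0 2 ^ s) ((R.A 1 0 ^ p) L) with hy'
  have c : ∀ r, R.A 0 1 ((R.A 2 1 ^ r) y) =
      ((q ^ (-s : ℝ) * (qNum q (p + 1) * qNum q (D - p)) : ℝ) : ℂ) • (R.A 2 1 ^ r) y' := by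
    intro r
    have := congrArg (fun f : Module.End ℂ V => f y) (R.commute_12_32.pow_right r)
    simp only [Module.End.mul_apply] at this
    rw [this, hy, h.apply_12_pow_13_pow_21 hq hq1, map_smul]
  have c' : ∀ r : ℕ, R.A 0 2 ((R.A 2 1 ^ (r + 1)) y) =
      -((q ^ (r - (N + 1) : ℝ) * qNum q (s - r) * (qNum q (p + 1) * qNum q (D - p)) : ℝ) : ℂ) •
        (R.A 2 1 ^ r) y' := by
    intro r
    rw [hy, h.apply_13_pow_32_pow_13_pow_21 hq hq1,
      show (r - (F + p + s - 1) : ℝ) = r - (N + 1) by rw [hN']; ring]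
  -- Here `F ≥ 2` gives `p ≤ N`, so the sum cut off at `2T` loses nothing.
  have top : (R.A 2 1 ^ (N + 1)) y' = 0 :=
    h.pow_32_pow_13_pow_21_eq_zero hq hq1 s p (N + 1) (by omega)
  have step : ∀ r : ℕ, R.A 0 1 ((R.A 1 2 ^ r) ((R.A 2 1 ^ r) y)) =
      ((q ^ (r : ℝ) : ℝ) : ℂ) • (R.A 1 2 ^ r) (R.A 0 1 ((R.A 2 1 ^ r) y)) +
        (qNum q r : ℂ) • (R.A 1 2 ^ (r - 1)) (R.A 0 2 ((R.A 2 1 ^ r) y)) := by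
    intro r
    cases r with
    | zero => simp
    | succ r => rw [R.apply_12_pow_23 hq hq1]; simp
  rw [projT_natCast, projT_natCast, map_sum, Finset.smul_sum]
  simp only [map_smul, step, smul_add]
  rw [Finset.sum_add_distrib, Finset.sum_range_succ, c (N + 1), top,
    Finset.sum_range_succ' _ (N + 1)]
  simp only [smul_zero, map_zero, add_zero, Nat.cast_zero, qNum_zero, Complex.ofReal_zero,
    zero_smul, ← Finset.sum_add_distrib]
  refine Finset.sum_congr rfl fun r hr => ?_
  have e := projTCoeff_recurrence hq hq1 (Finset.mem_range_succ_iff.1 hr) s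
  refine Eq.trans ?_ ((congrArg (fun z : ℝ => ((qNum q (p + 1) * qNum q (D - p) * z : ℝ) : ℂ) •
    (R.A 1 2 ^ r) ((R.A 2 1 ^ r) y')) e).trans (by push_cast; module))
  rw [c, c', Nat.add_sub_cancel, map_smul, map_smul]
  push_cast
  module

end IsLowest

/-! ### Powers of `A_{23}` and `A_{32}` across the inner product. -/

theorem inner_pow_23_left (j : ℕ) (u v : V) :
    inner ℂ ((R.A 1 2 ^ j) u) v = (-1) ^ j * inner ℂ u ((R.A 2 1 ^ j) v) := by
  induction j generalizing v with
  | zero => simp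
  | succ j ih =>
    rw [pow_succ_apply', R.adj_23, ih, ← pow_succ_apply, pow_succ]
    ring

theorem inner_pow_23_right (j : ℕ) (u v : V) :
    inner ℂ u ((R.A 1 2 ^ j) v) = (-1) ^ j * inner ℂ ((R.A 2 1 ^ j) u) v := by
  induction j generalizing u with
  | zero => simp
  | succ j ih =>
    rw [pow_succ_apply', R.inner_23, ih, ← pow_succ_apply, pow_succ]
    ring

theorem pow_apply_mem_weightSpace {v : V} {m : Fin 3 → ℝ} (hv : v ∈ weightSpace R.A m)
    {j k : Fin 3} (hjk : j ≠ k) (r : ℕ) :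
    (R.A j k ^ r) v ∈ weightSpace R.A
      (fun i => m i + r * ((if i = j then 1 else 0) - (if i = k then 1 else 0))) := by
  induction r with
  | zero => simpa using hv
  | succ r ih =>
    rw [pow_succ_apply']
    convert apply_mem_weightSpace ih hjk using 2
    funext i
    push_cast
    ring

theorem HasWeight.pow_32_pow_23 (hq : 0 < q) (hq1 : q ≠ 1) {w : V} {x : ℝ} {E : ℤ} (hE : 1 ≤ E)
    (hw : R.HasWeight w x E) (hw0 : R.A 2 1 w = 0) (i j : ℕ) :
    (R.A 2 1 ^ j) ((R.A 1 2 ^ (i + j)) w) =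
      (((-1) ^ j * (qFact q (i + j : ℕ) / qFact q i *
        (qFact q (E + (i + j : ℕ) - 1) / qFact q (E + i - 1))) : ℝ) : ℂ) •
        (R.A 1 2 ^ i) w := by
  have h1 := (qFact_pos hq hq1 i).ne'
  have h2 := (qFact_pos hq hq1 (E + i - 1)).ne'
  induction j with
  | zero => simp [h1, h2]
  | succ j ih =>
    have h3 : qFact q ((i + (j + 1) : ℕ) : ℤ) = qFact q (i + j : ℕ) * qNum q ((i + j : ℕ) + 1) :=
      qFact_succ_of_eq q (by omega) (by push_cast; ring) (by push_cast; ring)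
    have h4 : qFact q (E + (i + (j + 1) : ℕ) - 1) =
        qFact q (E + (i + j : ℕ) - 1) * qNum q (E + (i + j : ℕ)) :=
      qFact_succ_of_eq q (by omega) (by push_cast; ring) (by push_cast; ring)
    rw [pow_succ_apply, ← add_assoc, hw.apply_32_pow_23 hq hq1, hw0, map_zero, zero_sub, map_neg,
      map_smul, ih, add_assoc, h3, h4]
    push_cast
    rw [← neg_smul, smul_smul]
    congr 1
    ring

theorem HasWeight.pow_32_pow_23_eq_zero (hq : 0 < q) (hq1 : q ≠ 1) {w : V} {x : ℝ} {E : ℤ}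
    (hE : 1 ≤ E) (hw : R.HasWeight w x E) (hw0 : R.A 2 1 w = 0) {b j : ℕ} (hbj : b < j) :
    (R.A 2 1 ^ j) ((R.A 1 2 ^ b) w) = 0 := by
  apply pow_apply_eq_zero_of_le (N := b + 1) _ hbj
  have := hw.pow_32_pow_23 hq hq1 hE hw0 0 b
  rw [zero_add] at this
  rw [pow_succ_apply', this, map_smul, pow_zero, Module.End.one_apply, hw0, smul_zero]

namespace IsLowest

variable {L : V} {D F : ℤ}

theorem pow_32_pow_21_pow_13 (h : R.IsLowest L D F) (hq : 0 < q) (hq1 : q ≠ 1) (hDF : 1 ≤ D + F)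
    (c m j : ℕ) :
    (R.A 2 1 ^ j) ((R.A 1 0 ^ (c + j)) ((R.A 0 2 ^ (m + j)) L)) =
      (((-1) ^ j * (qFact q (c + j : ℕ) / qFact q c * (qFact q (m + j : ℕ) / qFact q m) *
        (qFact q (D + F + (m + j : ℕ) - 1) / qFact q (D + F + m - 1))) : ℝ) : ℂ) •
        (R.A 1 0 ^ c) ((R.A 0 2 ^ m) L) := by
  have h1 := (qFact_pos hq hq1 c).ne'
  have h2 := (qFact_pos hq hq1 m).ne'
  have h3 := (qFact_pos hq hq1 (D + F + m - 1)).ne'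
  induction j with
  | zero => simp [h1, h2, h3]
  | succ j ih =>
    have h4 : qFact q ((c + (j + 1) : ℕ) : ℤ) = qFact q (c + j : ℕ) * qNum q ((c + j : ℕ) + 1) :=
      qFact_succ_of_eq q (by omega) (by push_cast; ring) (by push_cast; ring)
    have h5 : qFact q ((m + (j + 1) : ℕ) : ℤ) = qFact q (m + j : ℕ) * qNum q ((m + j : ℕ) + 1) :=
      qFact_succ_of_eq q (by omega) (by push_cast; ring) (by push_cast; ring)
    have h6 : qFact q (D + F + (m + (j + 1) : ℕ) - 1) =
        qFact q (D + F + (m + j : ℕ) - 1) * qNum q (D + F + (m + j : ℕ)) :=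
      qFact_succ_of_eq q (by omega) (by push_cast; ring) (by push_cast; ring)
    rw [pow_succ_apply, ← add_assoc, ← add_assoc, h.apply_32_pow_21_pow_13 hq hq1, map_smul, ih,
      add_assoc c, add_assoc m, h4, h5, h6, smul_smul]
    push_cast
    congr 1
    ring

/-- Reordering `A_{13}` and `A_{21}` creates only terms containing `A_{23}`, which commutes with
`A_{21}` and can be pulled to the front. Such terms are orthogonal to vectors killed by `A_{32}`. -/
theorem exists_pow_13_pow_21_eq_add (h : R.IsLowest L D F) (hq : 0 < q) (hq1 : q ≠ 1)
    (s p : ℕ) :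
    ∃ w, (R.A 0 2 ^ s) ((R.A 1 0 ^ p) L) = (R.A 1 0 ^ p) ((R.A 0 2 ^ s) L) + R.A 1 2 w := by
  induction p with
  | zero => exact ⟨0, by simp⟩
  | succ p ih =>
    obtain ⟨w, hw⟩ := ih
    rcases s with - | s
    · exact ⟨0, by simp⟩
    refine ⟨R.A 1 0 w - ((q ^ (D - 2 * p : ℝ) * qNum q (s + 1) : ℝ) : ℂ) •
      (R.A 0 2 ^ s) ((R.A 1 0 ^ p) L), ?_⟩
    rw [pow_succ_apply' _ p, (h.weight.pow_21 p).pow_13_apply_21 hq hq1, hw, map_add, map_sub,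
      map_smul, ← R.apply_23_21, pow_succ_apply' _ p]
    abel

/-- The vector `A_{13}^s A_{21}^p |L⟩` has weight `2T + 2 = F + p + s` for `su_q(1,1)`. -/
theorem hasWeight_pow_13_pow_21 (h : R.IsLowest L D F) (s p : ℕ) :
    R.HasWeight ((R.A 0 2 ^ s) ((R.A 1 0 ^ p) L)) (D - 2 * p + s) ((F + p + s : ℤ) : ℝ) :=
  ((h.weight.pow_21 p).pow_13 s).congr rfl (by push_cast; ring)

theorem apply_32_projT (h : R.IsLowest L D F) (hq : 0 < q) (hq1 : q ≠ 1) (hF : 2 ≤ F)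
    (s p : ℕ) :
    R.A 2 1 (R.projT (F + p + s - 2) ((R.A 0 2 ^ s) ((R.A 1 0 ^ p) L))) = 0 := by
  obtain ⟨N, hN⟩ := Int.eq_ofNat_of_zero_le (show 0 ≤ F + p + s - 2 by omega)
  have hN' : (F + p + s - 2 : ℝ) = N := by exact_mod_cast hN
  rw [hN]
  exact UnitaryRep.apply_32_projT hq hq1
    (h.pow_32_pow_13_pow_21_eq_zero hq hq1 s p (N + 1) (by omega))
    ((h.hasWeight_pow_13_pow_21 s p).congr rfl (by push_cast; linarith))

theorem hasWeight_projT (h : R.IsLowest L D F) (n : ℤ) (s p : ℕ) :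
    R.HasWeight (R.projT n ((R.A 0 2 ^ s) ((R.A 1 0 ^ p) L))) (D - 2 * p + s)
      ((F + p + s : ℤ) : ℝ) := by
  obtain ⟨m, hm, hx, hy⟩ := h.hasWeight_pow_13_pow_21 s p
  refine ⟨m, Submodule.sum_mem _ fun r _ => Submodule.smul_mem _ _ ?_, hx, hy⟩
  have := pow_apply_mem_weightSpace (pow_apply_mem_weightSpace hm (j := 2) (k := 1) (by decide) r)
    (j := 1) (k := 2) (by decide) r
  convert this using 2
  funext i
  ring

/-! ### Norms of the extremal vectors. -/

theorem inner_projT (h : R.IsLowest L D F) (hq : 0 < q) (hq1 : q ≠ 1)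
    (hL : inner ℂ L L = 1) (hD : 0 ≤ D) (hF : 2 ≤ F) (s p : ℕ) (hp : (p : ℤ) ≤ D) :
    inner ℂ ((R.A 1 0 ^ p) ((R.A 0 2 ^ s) L))
        (R.projT (F + p + s - 2) ((R.A 0 2 ^ s) ((R.A 1 0 ^ p) L))) =
      ((qFact q p * (qFact q D / qFact q (D - p)) * (qFact q (F + p - 2) / qFact q (F - 2)) *
        (qFact q (F + s - 2) / qFact q (F + p + s - 2)) *
        (qFact q s * qFact q (D + F + s - 1) / qFact q (D + F - 1)) : ℝ) : ℂ) := by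
  have h1 := (qFact_pos hq hq1 D).ne'
  have h2 := (qFact_pos hq hq1 (F - 2)).ne'
  have h3 := (qFact_pos hq hq1 (F + s - 2)).ne'
  induction p with
  | zero =>
    obtain ⟨N, hN⟩ := Int.eq_ofNat_of_zero_le (show 0 ≤ F + s - 2 by omega)
    have e : R.projT (F + s - 2) ((R.A 0 2 ^ s) L) = (R.A 0 2 ^ s) L := by
      rw [hN, projT_natCast, Finset.sum_range_succ']
      simp [pow_succ_apply, h.apply_32_pow_13 hq hq1, projTCoeff_zero hq hq1]
    simp only [Nat.cast_zero, add_zero, pow_zero, Module.End.one_apply, e,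
      h.inner_pow_13_eq hq hq1 hL (by omega : 1 ≤ D + F) s, sub_zero, qFact_zero, div_self h1,
      div_self h2, div_self h3, one_mul]
  | succ p ih =>
    obtain ⟨N, hN⟩ := Int.eq_ofNat_of_zero_le (show 0 ≤ F + p + s - 2 by omega)
    have hN' : F + (p + 1 : ℕ) + s - 2 = (N + 1 : ℕ) := by push_cast; omega
    have hN'' : (N : ℝ) = F + p + s - 2 := by exact_mod_cast hN.symm
    have g1 : qFact q ((p + 1 : ℕ) : ℤ) = qFact q p * qNum q (p + 1) :=
      qFact_succ_of_eq q (by omega) (by push_cast; ring) (by push_cast; ring)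
    have g2 : qFact q (D - p) = qFact q (D - (p + 1 : ℕ)) * qNum q (D - p) :=
      qFact_succ_of_eq q (by omega) (by push_cast; ring) (by push_cast; ring)
    have g3 : qFact q (F + (p + 1 : ℕ) - 2) = qFact q (F + p - 2) * qNum q (F + p - 1) :=
      qFact_succ_of_eq q (by omega) (by push_cast; ring) (by push_cast; ring)
    have g4 : qFact q ((N + 1 : ℕ) : ℤ) = qFact q N * qNum q (N + 1) :=
      qFact_succ_of_eq q (by omega) (by push_cast; ring) (by push_cast; ring)
    have hDp : (p + 1 : ℝ) ≤ D := by exact_mod_cast hp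
    have := (qNum_pos hq hq1 (x := (D : ℝ) - p) (by linarith)).ne'
    have := (qNum_pos hq hq1 (x := (N : ℝ) + 1) (by positivity)).ne'
    have := (qFact_pos hq hq1 (D - (p + 1 : ℕ))).ne'
    -- The left vector has its `A_{21}` outermost, so one factor crosses over as `A_{12}` and lowers
    -- `p`.
    rw [pow_succ_apply', ← R.inner_12, hN', h.apply_12_projT hq hq1 s p N hN.symm hF, inner_smul_right,
      ← hN, ih (by omega), hN, g1, g2, g3, g4, ← Complex.ofReal_mul,
      show (N + 1 - s : ℝ) = F + p - 1 by rw [hN'']; ring]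
    congr 1
    field_simp

theorem inner_projT_self (h : R.IsLowest L D F) (hq : 0 < q) (hq1 : q ≠ 1) (hF : 2 ≤ F)
    (s p : ℕ) :
    inner ℂ (R.projT (F + p + s - 2) ((R.A 0 2 ^ s) ((R.A 1 0 ^ p) L)))
        (R.projT (F + p + s - 2) ((R.A 0 2 ^ s) ((R.A 1 0 ^ p) L))) =
      inner ℂ ((R.A 1 0 ^ p) ((R.A 0 2 ^ s) L))
        (R.projT (F + p + s - 2) ((R.A 0 2 ^ s) ((R.A 1 0 ^ p) L))) := by
  obtain ⟨w, hw⟩ := exists_projT_eq_add (R := R) hq hq1 (F + p + s - 2)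
    ((R.A 0 2 ^ s) ((R.A 1 0 ^ p) L))
  obtain ⟨w', hw'⟩ := h.exists_pow_13_pow_21_eq_add hq hq1 s p
  nth_rewrite 1 [hw, hw']
  rw [inner_add_left, inner_add_left, R.adj_23, R.adj_23, h.apply_32_projT hq hq1 hF]
  simp

theorem inner_projU (h : R.IsLowest L D F) (hq : 0 < q) (hq1 : q ≠ 1)
    (hL : inner ℂ L L = 1) (hD : 0 ≤ D) (hF : 2 ≤ F) (k l : ℕ) (hk : (k : ℤ) ≤ D) :
    inner ℂ ((R.A 1 2 ^ k) ((R.A 0 2 ^ l) L))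
        (R.projU (D - k + l) ((R.A 1 2 ^ k) ((R.A 0 2 ^ l) L))) =
      ((qFact q k * (qFact q D / qFact q (D - k)) * (qFact q (F + k - 2) / qFact q (F - 2)) *
        (qFact q (D - k + l + 1) / qFact q (D + l + 1)) *
        (qFact q l * qFact q (D + F + l - 1) / qFact q (D + F - 1)) : ℝ) : ℂ) := by
  have h1 := (qFact_pos hq hq1 D).ne'
  have h2 := (qFact_pos hq hq1 (F - 2)).ne'
  have h3 := (qFact_pos hq hq1 (D + l + 1)).ne'
  induction k with
  | zero =>
    have e : R.projU (D + l) ((R.A 0 2 ^ l) L) = (R.A 0 2 ^ l) L := by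
      rw [projU_eq_sum (N := 1) (by simpa using h.apply_12_pow_13 hq l)]
      simp [projUCoeff_zero hq hq1]
    simp only [Nat.cast_zero, add_zero, pow_zero, Module.End.one_apply, e,
      h.inner_pow_13_eq hq hq1 hL (by omega : 1 ≤ D + F) l, sub_zero, qFact_zero, div_self h1,
      div_self h2, div_self h3, one_mul]
  | succ k ih =>
    have g1 : qFact q ((k + 1 : ℕ) : ℤ) = qFact q k * qNum q (k + 1) :=
      qFact_succ_of_eq q (by omega) (by push_cast; ring) (by push_cast; ring)
    have g2 : qFact q (D - k) = qFact q (D - (k + 1 : ℕ)) * qNum q (D - k) :=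
      qFact_succ_of_eq q (by omega) (by push_cast; ring) (by push_cast; ring)
    have g3 : qFact q (F + (k + 1 : ℕ) - 2) = qFact q (F + k - 2) * qNum q (F + k - 1) :=
      qFact_succ_of_eq q (by omega) (by push_cast; ring) (by push_cast; ring)
    have g4 : qFact q (D - k + l + 1) = qFact q (D - (k + 1 : ℕ) + l + 1) * qNum q (D - k + l + 1) :=
      qFact_succ_of_eq q (by omega) (by push_cast; ring) (by push_cast; ring)
    have hDk : (k + 1 : ℝ) ≤ D := by exact_mod_cast hk
    have := (qNum_pos hq hq1 (x := (D : ℝ) - k) (by linarith)).ne'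
    have : qNum q (D - k + l + 1) ≠ 0 := (qNum_pos hq hq1 (by
      have : (0 : ℝ) ≤ l := by positivity
      linarith)).ne'
    have := (qFact_pos hq hq1 (D - (k + 1 : ℕ))).ne'
    have e := h.apply_32_projU hq hq1 k l hk
    nth_rewrite 1 [pow_succ_apply']
    -- The sign in the adjoint of `A_{23}` cancels the sign in `apply_32_projU`.
    rw [R.adj_23, e, neg_smul, inner_neg_right, neg_neg, inner_smul_right, ih (by omega), g1, g2,
      g3, g4, ← Complex.ofReal_mul]
    congr 1
    field_simp

theorem inner_projU_self (h : R.IsLowest L D F) (hq : 0 < q) (hq1 : q ≠ 1) (k l : ℕ)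
    (hk : (k : ℤ) ≤ D) :
    inner ℂ (R.projU (D - k + l) ((R.A 1 2 ^ k) ((R.A 0 2 ^ l) L)))
        (R.projU (D - k + l) ((R.A 1 2 ^ k) ((R.A 0 2 ^ l) L))) =
      inner ℂ ((R.A 1 2 ^ k) ((R.A 0 2 ^ l) L))
        (R.projU (D - k + l) ((R.A 1 2 ^ k) ((R.A 0 2 ^ l) L))) := by
  have h0 := h.pow_12_pow_23_pow_13_eq_zero hq hq1 k l
  obtain ⟨w, hw⟩ := exists_projU_eq_add (R := R) hq hq1 h0 (D - k + l)
  nth_rewrite 1 [hw]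
  rw [inner_add_left, ← R.inner_12,
    apply_12_projU hq hq1 h0 (by omega) (h.hasWeight_pow_23_pow_13 k l)]
  simp

end IsLowest

/-! ### The overlap of the unnormalized basis vectors. -/

theorem cancel_signs (i j : ℕ) (x y : ℝ) (z : ℂ) :
    (-1) ^ i * ((((-1) ^ i * x : ℝ) : ℂ) * ((-1) ^ j * ((((-1) ^ j * y : ℝ) : ℂ) * z))) =
      ((x * y : ℝ) : ℂ) * z := by
  have h : ∀ n : ℕ, ((-1 : ℂ)) ^ n * (-1) ^ n = 1 := fun n => by rw [← mul_pow]; simp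
  push_cast
  linear_combination (x * y * z * (-1) ^ j * (-1) ^ j) * h i + x * y * z * h j

namespace IsLowest

variable {L : V} {D F : ℤ}

theorem inner_pow_23_pow_21_pow_13_of_lt (h : R.IsLowest L D F) (hq : 0 < q) (hq1 : q ≠ 1)
    (hF : 2 ≤ F) {s p b i : ℕ} (hi : b < i) (u : V) :
    inner ℂ ((R.A 1 2 ^ i) u) ((R.A 1 2 ^ b)
      (R.projT (F + p + s - 2) ((R.A 0 2 ^ s) ((R.A 1 0 ^ p) L)))) = 0 := by
  rw [inner_pow_23_left, (h.hasWeight_projT _ s p).pow_32_pow_23_eq_zero hq hq1 (by omega)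
    (h.apply_32_projT hq hq1 hF s p) hi, inner_zero_right, mul_zero]

/-- `A_{23}^i` crosses to the right and is absorbed by `A_{23}^{j+i}`; the remaining `A_{23}^j`
crosses to the left and is absorbed by `A_{21}` and `A_{13}`. Each crossing sign cancels the sign
from the corresponding `A_{32}` action. -/
theorem inner_pow_23_pow_21_pow_13 (h : R.IsLowest L D F) (hq : 0 < q) (hq1 : q ≠ 1)
    (hD : 0 ≤ D) (hF : 2 ≤ F) (s p i j : ℕ) :
    inner ℂ ((R.A 1 2 ^ i) ((R.A 1 0 ^ (p + j)) ((R.A 0 2 ^ (s + j)) L)))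
      ((R.A 1 2 ^ (j + i)) (R.projT (F + p + s - 2) ((R.A 0 2 ^ s) ((R.A 1 0 ^ p) L)))) =
    ((qFact q (j + i : ℕ) / qFact q j *
        (qFact q (F + p + s + (j + i : ℕ) - 1) / qFact q (F + p + s + j - 1)) *
        (qFact q (p + j : ℕ) / qFact q p * (qFact q (s + j : ℕ) / qFact q s) *
          (qFact q (D + F + (s + j : ℕ) - 1) / qFact q (D + F + s - 1))) : ℝ) : ℂ) *
      inner ℂ ((R.A 1 0 ^ p) ((R.A 0 2 ^ s) L))
        (R.projT (F + p + s - 2) ((R.A 0 2 ^ s) ((R.A 1 0 ^ p) L))) := by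
  rw [inner_pow_23_left, (h.hasWeight_projT _ s p).pow_32_pow_23 hq hq1 (by omega)
    (h.apply_32_projT hq hq1 hF s p), inner_smul_right, inner_pow_23_right,
    h.pow_32_pow_21_pow_13 hq hq1 (by omega), inner_smul_left, Complex.conj_ofReal]
  exact cancel_signs i j _ _ _

end IsLowest

theorem inner_pow_21_highU_pow_23_lowT (hq : 0 < q) (hq1 : q ≠ 1) {f₁ f₂ f₃ : ℤ} {L : V}
    (h : R.IsLowest L (f₁ - f₂) (f₂ - f₃)) (hf₁₂ : f₂ ≤ f₁) (hf₂₃ : 2 ≤ f₂ - f₃)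
    (k l a s p b : ℕ) (hab : (a : ℤ) = p - s + l) (hbw : (b : ℤ) = k + l - s) :
    inner ℂ ((R.A 1 0 ^ a) (R.highU f₁ f₂ L k l)) ((R.A 1 2 ^ b) (R.lowT f₂ f₃ L s p)) =
      ((qFact q (f₁ - f₂ - k + l + 1) * qFact q k * qFact q b * qFact q (f₂ - f₃ + p + s - 1 + b) /
        (qFact q p * qFact q s * qFact q (f₁ - f₃ + s - 1)) *
        weylSum q f₁ f₂ f₃ k l s p a (f₁ - f₂ - k + l) : ℝ) : ℂ) *
      inner ℂ ((R.A 1 0 ^ p) ((R.A 0 2 ^ s) L)) (R.lowT f₂ f₃ L s p) := by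
  rw [highU, h.projU_pow_23_pow_13 hq hq1, map_sum, sum_inner, weylSum, Finset.sum_filter,
    Finset.mul_sum, Complex.ofReal_sum, Finset.sum_mul]
  refine Finset.sum_congr rfl fun r hr => ?_
  rw [Finset.mem_range_succ_iff] at hr
  rw [map_smul, inner_smul_left, Complex.conj_ofReal, pow_21_pow_23,
    ← Module.End.mul_apply _ (_ ^ r), ← pow_add, lowT]
  split_ifs with hs
  -- With `j = l + r - s`, equality of the weights becomes `b = j + (k - r)` and `a + r = p + j`.
  · obtain ⟨j, hj⟩ := Nat.exists_eq_add_of_le hs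
    obtain rfl : b = j + (k - r) := by omega
    obtain hpj : a + r = p + j := by omega
    have e1 : (f₁ - f₂ + (f₂ - f₃) + (s + j : ℕ) - 1) = f₁ - f₃ + l + r - 1 := by
      rw [← hj]; push_cast; ring
    have e2 : (f₁ - f₂ + (f₂ - f₃) + s - 1) = f₁ - f₃ + s - 1 := by ring
    have e3 : (l - s + r : ℤ) = j := by omega
    have e4 : (k - r : ℤ) = (k - r : ℕ) := by omega
    have e5 : f₂ - f₃ + p + s + j - 1 = f₂ - f₃ + p + l + r - 1 := by omega
    have e6 : f₂ - f₃ + p + s - 1 + (j + (k - r) : ℕ) = f₂ - f₃ + p + s + (j + (k - r) : ℕ) - 1 := by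
      ring
    have e7 : (a + r : ℤ) = (p + j : ℕ) := by omega
    have e8 : (l + r : ℤ) = (s + j : ℕ) := by omega
    rw [hj, hpj, h.inner_pow_23_pow_21_pow_13 hq hq1 (by omega) hf₂₃, ← mul_assoc,
      ← Complex.ofReal_mul, projUCoeff, e1, e2, e3, e4, e5, e6, e7, e8]
    congr 2
    ring
  -- Here `l + r < s` means `b < k - r`: too many `A_{32}` act, which explains the summation range.
  · rw [h.inner_pow_23_pow_21_pow_13_of_lt hq hq1 hf₂₃ (by omega)]
    simp

theorem norm_highU_sq (hq : 0 < q) (hq1 : q ≠ 1) {f₁ f₂ f₃ : ℤ} {L : V}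
    (h : R.IsLowest L (f₁ - f₂) (f₂ - f₃)) (hL : inner ℂ L L = 1) (hf₁₂ : f₂ ≤ f₁)
    (hf₂₃ : 2 ≤ f₂ - f₃) (k l : ℕ) (hk : (k : ℤ) ≤ f₁ - f₂) :
    ‖R.highU f₁ f₂ L k l‖ ^ 2 =
      qFact q k * (qFact q (f₁ - f₂) / qFact q (f₁ - f₂ - k)) *
        (qFact q (f₂ - f₃ + k - 2) / qFact q (f₂ - f₃ - 2)) *
        (qFact q (f₁ - f₂ - k + l + 1) / qFact q (f₁ - f₂ + l + 1)) *
        (qFact q l * qFact q (f₁ - f₃ + l - 1) / qFact q (f₁ - f₃ - 1)) := by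
  have e := (h.inner_projU_self hq hq1 k l hk).trans
    (h.inner_projU hq hq1 hL (by omega) hf₂₃ k l hk)
  rw [inner_self_eq_norm_sq_to_K, sub_add_sub_cancel] at e
  exact Complex.ofReal_injective ((Complex.ofReal_pow _ _).trans e)

theorem inner_lowT (hq : 0 < q) (hq1 : q ≠ 1) {f₁ f₂ f₃ : ℤ} {L : V}
    (h : R.IsLowest L (f₁ - f₂) (f₂ - f₃)) (hf₂₃ : 2 ≤ f₂ - f₃) (s p : ℕ) :
    inner ℂ ((R.A 1 0 ^ p) ((R.A 0 2 ^ s) L)) (R.lowT f₂ f₃ L s p) =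
      ((‖R.lowT f₂ f₃ L s p‖ ^ 2 : ℝ) : ℂ) := by
  have e := h.inner_projT_self hq hq1 hf₂₃ s p
  rw [inner_self_eq_norm_sq_to_K] at e
  exact e.symm.trans (by push_cast; rfl)

theorem norm_lowT_sq (hq : 0 < q) (hq1 : q ≠ 1) {f₁ f₂ f₃ : ℤ} {L : V}
    (h : R.IsLowest L (f₁ - f₂) (f₂ - f₃)) (hL : inner ℂ L L = 1) (hf₁₂ : f₂ ≤ f₁)
    (hf₂₃ : 2 ≤ f₂ - f₃) (s p : ℕ) (hp : (p : ℤ) ≤ f₁ - f₂) :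
    ‖R.lowT f₂ f₃ L s p‖ ^ 2 =
      qFact q p * (qFact q (f₁ - f₂) / qFact q (f₁ - f₂ - p)) *
        (qFact q (f₂ - f₃ + p - 2) / qFact q (f₂ - f₃ - 2)) *
        (qFact q (f₂ - f₃ + s - 2) / qFact q (f₂ - f₃ + p + s - 2)) *
        (qFact q s * qFact q (f₁ - f₃ + s - 1) / qFact q (f₁ - f₃ - 1)) := by
  have e := (inner_lowT hq hq1 h hf₂₃ s p).symm.trans
    (h.inner_projT hq hq1 hL (by omega) hf₂₃ s p hp)
  rw [sub_add_sub_cancel] at e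
  exact_mod_cast e

theorem weylPrefactor_eq (hq : 0 < q) (hq1 : q ≠ 1) {f₁ f₂ f₃ : ℤ} {L : V}
    (h : R.IsLowest L (f₁ - f₂) (f₂ - f₃)) (hL : inner ℂ L L = 1) (hf₁₂ : f₂ ≤ f₁)
    (hf₂₃ : 2 ≤ f₂ - f₃) (k l a s p b : ℕ) (hk : (k : ℤ) ≤ f₁ - f₂) (hp : (p : ℤ) ≤ f₁ - f₂) :
    weylPrefactor q f₁ f₂ f₃ k l s p a b (f₁ - f₂ - k + l) (f₂ - f₃ + p + s - 2) =
      (‖R.highU f₁ f₂ L k l‖ *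
        √(qFact q (f₁ - f₂ - k + l) * qFact q a / qFact q (f₁ - f₂ - k + l - a)))⁻¹ *
      (‖R.lowT f₂ f₃ L s p‖ * √(qFact q b * qFact q (f₂ - f₃ + p + s - 2 + 1 + b) /
        qFact q (f₂ - f₃ + p + s - 2 + 1)))⁻¹ *
      (qFact q (f₁ - f₂ - k + l + 1) * qFact q k * qFact q b * qFact q (f₂ - f₃ + p + s - 1 + b) /
        (qFact q p * qFact q s * qFact q (f₁ - f₃ + s - 1)) * ‖R.lowT f₂ f₃ L s p‖ ^ 2) := by
  have pos := qFact_pos hq hq1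
  have g1 : qFact q (f₁ - f₂ - k + l + 1) =
      qFact q (f₁ - f₂ - k + l) * qNum q ((f₁ - f₂ - k + l : ℤ) + 1) :=
    qFact_succ_of_eq q (by omega) rfl (by push_cast; ring)
  have g2 : qFact q (f₂ - f₃ + p + s - 2 + 1) =
      qFact q (f₂ - f₃ + p + s - 2) * qNum q ((f₂ - f₃ + p + s - 2 : ℤ) + 1) :=
    qFact_succ_of_eq q (by omega) rfl (by push_cast; ring)
  have g3 : qFact q (f₂ - f₃ + p + s - 1 + b) = qFact q (f₂ - f₃ + p + s - 2 + 1 + b) := by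
    congr 1; ring
  have hn : 0 < qNum q ((f₁ - f₂ - k + l : ℤ) + 1) := by
    refine qNum_pos hq hq1 ?_
    have : (0 : ℝ) ≤ (f₁ - f₂ - k + l : ℤ) := by exact_mod_cast (by omega)
    linarith
  have ht : 0 < qNum q ((f₂ - f₃ + p + s - 2 : ℤ) + 1) := by
    refine qNum_pos hq hq1 ?_
    have : (0 : ℝ) ≤ (f₂ - f₃ + p + s - 2 : ℤ) := by exact_mod_cast (by omega)
    linarith
  have hU := norm_highU_sq hq hq1 h hL hf₁₂ hf₂₃ k l hk
  have hT := norm_lowT_sq hq hq1 h hL hf₁₂ hf₂₃ s p hp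
  rw [g1] at hU
  have h1 := pos k
  have h2 := pos l
  have h3 := pos a
  have h4 := pos s
  have h5 := pos p
  have h6 := pos b
  have h7 := pos (f₁ - f₂)
  have h8 := pos (f₁ - f₂ - k)
  have h9 := pos (f₂ - f₃ + k - 2)
  have h10 := pos (f₂ - f₃ - 2)
  have h11 := pos (f₁ - f₂ - k + l)
  have h12 := pos (f₁ - f₂ + l + 1)
  have h13 := pos (f₁ - f₃ + l - 1)
  have h14 := pos (f₁ - f₃ - 1)
  have h15 := pos (f₁ - f₂ - p)
  have h16 := pos (f₂ - f₃ + p - 2)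
  have h17 := pos (f₂ - f₃ + s - 2)
  have h18 := pos (f₂ - f₃ + p + s - 2)
  have h19 := pos (f₁ - f₃ + s - 1)
  have h20 := pos (f₁ - f₂ - k + l - a)
  have h21 := pos (f₂ - f₃ + p + s - 2 + 1 + b)
  rw [weylPrefactor, g1, g2, g3]
  have hU0 := norm_nonneg (R.highU f₁ f₂ L k l)
  have hT0 := norm_nonneg (R.lowT f₂ f₃ L s p)
  generalize ‖R.highU f₁ f₂ L k l‖ = u at *
  generalize ‖R.lowT f₂ f₃ L s p‖ = t at *
  clear g1 g2 g3 pos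
  generalize qFact q k = x1 at *
  generalize qFact q l = x2 at *
  generalize qFact q a = x3 at *
  generalize qFact q s = x4 at *
  generalize qFact q p = x5 at *
  generalize qFact q b = x6 at *
  generalize qFact q (f₁ - f₂) = x7 at *
  generalize qFact q (f₁ - f₂ - k) = x8 at *
  generalize qFact q (f₂ - f₃ + k - 2) = x9 at *
  generalize qFact q (f₂ - f₃ - 2) = x10 at *
  generalize qFact q (f₁ - f₂ - k + l) = x11 at *
  generalize qFact q (f₁ - f₂ + l + 1) = x12 at *
  generalize qFact q (f₁ - f₃ + l - 1) = x13 at *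
  generalize qFact q (f₁ - f₃ - 1) = x14 at *
  generalize qFact q (f₁ - f₂ - p) = x15 at *
  generalize qFact q (f₂ - f₃ + p - 2) = x16 at *
  generalize qFact q (f₂ - f₃ + s - 2) = x17 at *
  generalize qFact q (f₂ - f₃ + p + s - 2) = x18 at *
  generalize qFact q (f₁ - f₃ + s - 1) = x19 at *
  generalize qFact q (f₁ - f₂ - k + l - a) = x20 at *
  generalize qFact q (f₂ - f₃ + p + s - 2 + 1 + b) = x21 at *
  generalize qNum q ((f₁ - f₂ - k + l : ℤ) + 1) = y1 at *
  generalize qNum q ((f₂ - f₃ + p + s - 2 : ℤ) + 1) = y2 at *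
  -- The right-hand side is nonnegative, so its square need only be the radicand; this is rational
  -- algebra in positive quantities once both norm formulas are inserted.
  refine Eq.trans (congrArg Real.sqrt ?_) (Real.sqrt_sq (by positivity))
  rw [mul_pow, mul_pow, inv_pow, inv_pow, mul_pow, mul_pow, mul_pow _ (t ^ 2),
    Real.sq_sqrt (by positivity), Real.sq_sqrt (by positivity), hU, hT]
  field_simp

end UnitaryRep

/-! ### Reversal of the summation index and the final assembly. -/

theorem weylSum'_eq_weylSum (q : ℝ) (f₁ f₂ f₃ : ℤ) (k l s p a : ℕ) (n : ℤ) :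
    weylSum' q f₁ f₂ f₃ k l s p a n = weylSum q f₁ f₂ f₃ k l s p a n := by
  rw [weylSum, weylSum']
  refine Finset.sum_nbij' (fun j => k - j) (fun r => k - r) ?_ ?_ ?_ ?_ ?_
  · intro j hj
    simp only [Finset.mem_filter, Finset.mem_range] at hj ⊢
    omega
  · intro r hr
    simp only [Finset.mem_filter, Finset.mem_range] at hr ⊢
    omega
  · intro j hj
    simp only [Finset.mem_filter, Finset.mem_range] at hj ⊢
    omega
  · intro r hr
    simp only [Finset.mem_filter, Finset.mem_range] at hr ⊢
    omega
  · intro j hj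
    simp only [Finset.mem_filter, Finset.mem_range] at hj
    obtain ⟨r, rfl⟩ := Nat.exists_eq_add_of_le' (Nat.le_of_lt_succ hj.1)
    have h1 : (-1 : ℝ) ^ (r + j + j) = (-1) ^ r := by
      rw [add_assoc, pow_add, ← two_mul, pow_mul]; simp
    rw [Nat.add_sub_cancel, h1]
    push_cast
    simp only [show ∀ x : ℤ, x + (r + j) - j = x + r by intro x; ring,
      show (r + j - j : ℤ) = r by ring, show (r + j - r : ℤ) = j by ring,
      show n + 1 + r = n + r + 1 by ring]
    rw [div_mul_div_comm]
    congr 1 <;> ring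

theorem IsPositiveDiscrete.isLowest {q : ℝ} {R : UnitaryRep q V} {f₁ f₂ f₃ : ℤ} {L : V}
    (h : IsPositiveDiscrete R f₁ f₂ f₃ L) : R.IsLowest L (f₁ - f₂) (f₂ - f₃) where
  weight := by
    refine ⟨![f₁, f₂, f₃], UnitaryRep.mem_weightSpace_iff.2 fun i => ?_, by simp, by simp⟩
    fin_cases i
    · simpa using h.weight_1
    · simpa using h.weight_2
    · simpa using h.weight_3
  ann_12 := h.ann_12
  ann_32 := h.ann_32
  ann_31 := h.ann_31

end UqTwoOne

theorem mainTheorem2 (q : ℝ) (hq : 0 < q) (hq1 : q ≠ 1)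
    {V : Type*} [NormedAddCommGroup V] [InnerProductSpace ℂ V]
    (R : UqTwoOne.UnitaryRep q V) (f₁ f₂ f₃ : ℤ) (L : V)
    (hR : UqTwoOne.IsPositiveDiscrete R f₁ f₂ f₃ L)
    (hf₁₂ : f₂ ≤ f₁) (hf₂₃ : 2 ≤ f₂ - f₃)
    -- the labels of the two basis vectors: `a = U - M_U` and `b = M - T - 1`
    (k l a s p b : ℕ)
    (hk : (k : ℤ) ≤ f₁ - f₂) (ha : (a : ℤ) ≤ f₁ - f₂ - k + l) (hp : (p : ℤ) ≤ f₁ - f₂)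
    -- the two basis vectors have the same weight
    (hab : (a : ℤ) = p - s + l) (hbw : (b : ℤ) = k + l - s) :
    inner ℂ (R.uVec f₁ f₂ L k l a) (R.tVec f₂ f₃ L s p b) =
        ((UqTwoOne.weylPrefactor q f₁ f₂ f₃ k l s p a b (f₁ - f₂ - k + l) (f₂ - f₃ + p + s - 2) *
          UqTwoOne.weylSum q f₁ f₂ f₃ k l s p a (f₁ - f₂ - k + l) : ℝ) : ℂ) ∧
      inner ℂ (R.uVec f₁ f₂ L k l a) (R.tVec f₂ f₃ L s p b) =
        ((UqTwoOne.weylPrefactor q f₁ f₂ f₃ k l s p a b (f₁ - f₂ - k + l) (f₂ - f₃ + p + s - 2) *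
          UqTwoOne.weylSum' q f₁ f₂ f₃ k l s p a (f₁ - f₂ - k + l) : ℝ) : ℂ) := by
  rw [UqTwoOne.weylSum'_eq_weylSum, and_self]
  have h := hR.isLowest
  rw [UqTwoOne.UnitaryRep.weylPrefactor_eq hq hq1 h hR.norm_L hf₁₂ hf₂₃ k l a s p b hk hp,
    UqTwoOne.UnitaryRep.uVec, UqTwoOne.UnitaryRep.tVec, inner_smul_left, inner_smul_right,
    Complex.conj_ofReal,
    UqTwoOne.UnitaryRep.inner_pow_21_highU_pow_23_lowT hq hq1 h hf₁₂ hf₂₃ k l a s p b hab hbw,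
    UqTwoOne.UnitaryRep.inner_lowT hq hq1 h hf₂₃]
  simp only [← Complex.ofReal_mul]
  congr 1
  ring
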